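/- Let a HyperLTL formula over a finite set $\mathrm{AP}$ of atomic propositions be a prefix of trace quantifiers $\exists\pi$, $\forall\pi$ followed by a quantifier-free formula built from $a_\pi$ ($a\in\mathrm{AP}$) with $\neg$, $\vee$, $\bigcirc$ (next) and $\mathbin{\mathrm U}$ (until). Over a set $T$ of traces (sequences in $(2^{\mathrm{AP}})^\omega$) the quantifiers range over $T$, $a_\pi$ says that $a$ belongs to the first letter of the trace $\pi$, and the temporal operators have their usual meaning with all traces advancing synchronously. A finite Kripke structure $K$ over $\mathrm{AP}$ has finitely many states, one initial state, at least one successor for every state, and a label $L(s)\subseteq\mathrm{AP}$ for every state $s$; $K\models\psi$ means that the set of label sequences of the infinite paths from the initial state satisfies the closed formula $\psi$. $K$ is given as a binary word that lists, for each state, whether it is initial, its label as a bit vector, and its row of the adjacency matrix; thus the input size is polynomial in the number of states for fixed $\mathrm{AP}$. **Theorem.** For HyperLTL, model checking is PSPACE-hard in the size of the Kripke structure for a fixed formula with at least one quantifier alternation. Precisely: for every $k\ge 1$ there are a finite set $\mathrm{AP}$ and a closed HyperLTL formula $\psi$ over $\mathrm{AP}$ whose quantifier prefix has exactly $k$ alternations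 between $\exists$ and $\forall$, such that the problem "given a finite Kripke structure $K$ over $\mathrm{AP}$, does $K\models\psi$ hold?" is PSPACE-hard: every language over a finite alphabet that is decided by a deterministic Turing machine in polynomial space is polynomial-time many-one reducible to it. -/

import Mathlib

/-! ### HyperLTL: syntax and semantics over trace sets -/

namespace HyperLTL

/-- A trace: an infinite sequence of sets of atomic propositions. -/
abbrev Trace (AP : Type*) := ℕ → Set AP

/-- Quantifier-free HyperLTL formulas. Trace variables are natural numbers;
`atom a π` is the atomic proposition `a` read on the trace `π`. -/
inductive Body (AP : Type*) where
  | atom (a : AP) (π : ℕ) : Body AP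
  | neg (φ : Body AP) : Body AP
  | or (φ₁ φ₂ : Body AP) : Body AP
  | nxt (φ : Body AP) : Body AP
  | untl (φ₁ φ₂ : Body AP) : Body AP

/-- HyperLTL formulas: a prefix of trace quantifiers followed by a quantifier-free formula. -/
inductive Formula (AP : Type*) where
  | ex (π : ℕ) (ψ : Formula AP) : Formula AP
  | all (π : ℕ) (ψ : Formula AP) : Formula AP
  | body (φ : Body AP) : Formula AP

/-- A trace assignment: a partial function from trace variables to traces. -/
abbrev Assignment (AP : Type*) := ℕ → Option (Trace AP)

/-- The suffix `v[i,∞]` of a trace assignment. -/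
def Assignment.suffix {AP : Type*} (v : Assignment AP) (i : ℕ) : Assignment AP :=
  fun π => (v π).map fun t j => t (i + j)

/-- Semantics of quantifier-free formulas. -/
def Body.Sat {AP : Type*} : Assignment AP → Body AP → Prop
  | v, .atom a π => ∃ t, v π = some t ∧ a ∈ t 0
  | v, .neg φ => ¬ φ.Sat v
  | v, .or φ₁ φ₂ => φ₁.Sat v ∨ φ₂.Sat v
  | v, .nxt φ => φ.Sat (v.suffix 1)
  | v, .untl φ₁ φ₂ => ∃ i, φ₂.Sat (v.suffix i) ∧ ∀ j < i, φ₁.Sat (v.suffix j)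

/-- The validity judgment `v ⊨_T ψ`. -/
def Formula.Sat {AP : Type*} (T : Set (Trace AP)) : Assignment AP → Formula AP → Prop
  | v, .ex π ψ => ∃ t ∈ T, ψ.Sat T (Function.update v π (some t))
  | v, .all π ψ => ∀ t ∈ T, ψ.Sat T (Function.update v π (some t))
  | v, .body φ => φ.Sat v

/-- The trace variables occurring in a quantifier-free formula. -/
def Body.vars {AP : Type*} : Body AP → Set ℕ
  | .atom _ π => {π}
  | .neg φ => φ.vars
  | .or φ₁ φ₂ => φ₁.vars ∪ φ₂.vars
  | .nxt φ => φ.vars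
  | .untl φ₁ φ₂ => φ₁.vars ∪ φ₂.vars

/-- The free trace variables of a formula. -/
def Formula.freeVars {AP : Type*} : Formula AP → Set ℕ
  | .ex π ψ => ψ.freeVars \ {π}
  | .all π ψ => ψ.freeVars \ {π}
  | .body φ => φ.vars

/-- A formula is closed if every occurrence of a trace variable is bound. -/
def Formula.Closed {AP : Type*} (ψ : Formula AP) : Prop := ψ.freeVars = ∅

/-- The quantifier prefix of a formula: `true` for `∃`, `false` for `∀`. -/
def Formula.quantifiers {AP : Type*} : Formula AP → List Bool
  | .ex _ ψ => true :: ψ.quantifiers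
  | .all _ ψ => false :: ψ.quantifiers
  | .body _ => []

/-- The number of quantifier alternations: the number of adjacent pairs of different quantifiers
in the quantifier prefix. -/
def Formula.alternations {AP : Type*} (ψ : Formula AP) : ℕ :=
  (ψ.quantifiers.zip ψ.quantifiers.tail).countP fun p => p.1 != p.2

end HyperLTL

/-! ### Kripke structures -/

/-- A Kripke structure with states `S` and atomic propositions `AP`; every state has a
successor. -/
structure KripkeStructure (S AP : Type*) where
  init : S
  δ : S → Set S
  δ_nonempty : ∀ s, (δ s).Nonempty
  L : S → Set AP

namespace KripkeStructure

/-- The set of label sequences of the infinite paths that start in the initial state. -/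
def traces {S AP : Type*} (K : KripkeStructure S AP) : Set (HyperLTL.Trace AP) :=
  {t | ∃ p : ℕ → S, p 0 = K.init ∧ (∀ i, p (i + 1) ∈ K.δ (p i)) ∧ ∀ i, t i = K.L (p i)}

/-- `K ⊨ ψ`: the trace set of `K` satisfies `ψ` under the empty trace assignment. -/
def Satisfies {S AP : Type*} (K : KripkeStructure S AP) (ψ : HyperLTL.Formula AP) : Prop :=
  ψ.Sat K.traces (fun _ => none)

/-- The truth value of a proposition as a bit. -/
noncomputable def bit (P : Prop) : Bool := @decide P (Classical.propDecidable P)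

/-- The code of a state: whether it is initial, its label as a bit vector, and its row of the
adjacency matrix. -/
noncomputable def encodeState {n m : ℕ} (K : KripkeStructure (Fin n) (Fin m)) (s : Fin n) :
    List Bool :=
  bit (s = K.init) ::
    ((List.ofFn fun a => bit (a ∈ K.L s)) ++ List.ofFn fun t => bit (t ∈ K.δ s))

/-- The code of a finite Kripke structure as a binary word: the codes of its states in order. Its
length is `n * (1 + m + n)` for `n` states and `m` atomic propositions. -/
noncomputable def encode {n m : ℕ} (K : KripkeStructure (Fin n) (Fin m)) : List Bool :=
  (List.ofFn K.encodeState).flatten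

theorem length_encodeState {n m : ℕ} (K : KripkeStructure (Fin n) (Fin m)) (s : Fin n) :
    (K.encodeState s).length = 1 + m + n := by
  simp [encodeState]; omega

theorem length_encode {n m : ℕ} (K : KripkeStructure (Fin n) (Fin m)) :
    K.encode.length = n * (1 + m + n) := by
  simp [encode, List.length_flatten, List.map_ofFn, Function.comp_def, length_encodeState]

theorem bit_inj {P Q : Prop} (h : bit P = bit Q) : P ↔ Q := by
  simpa [bit] using h

theorem flatten_inj_of_length {k : ℕ} : ∀ {l l' : List (List Bool)}, l.length = l'.length →
    (∀ b ∈ l, b.length = k) → (∀ b ∈ l', b.length = k) → l.flatten = l'.flatten → l = l'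
  | [], [], _, _, _, _ => rfl
  | [], _ :: _, h, _, _, _ => by simp at h
  | _ :: _, [], h, _, _, _ => by simp at h
  | b :: l, b' :: l', h, hl, hl', e => by
    simp only [List.flatten_cons] at e
    obtain ⟨h1, h2⟩ := List.append_inj e ((hl b (by simp)).trans (hl' b' (by simp)).symm)
    rw [h1, flatten_inj_of_length (by simpa using h) (fun x hx => hl x (by simp [hx]))
      (fun x hx => hl' x (by simp [hx])) h2]

/-- The code determines the Kripke structure. -/
theorem encode_injective (m : ℕ) :
    Function.Injective fun K : Σ n, KripkeStructure (Fin n) (Fin m) => K.2.encode := by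
  rintro ⟨n, K⟩ ⟨n', K'⟩ h
  simp only at h
  have hn : n = n' := by
    have hlen := congrArg List.length h
    rw [length_encode, length_encode] at hlen
    rcases lt_trichotomy n n' with hlt | heq | hgt
    · nlinarith
    · exact heq
    · nlinarith
  subst hn
  have hs : ∀ s, K.encodeState s = K'.encodeState s := by
    have := flatten_inj_of_length (k := 1 + m + n) (by simp)
      (by simp [List.mem_ofFn, length_encodeState])
      (by simp [List.mem_ofFn, length_encodeState]) h
    exact fun s => congrFun (List.ofFn_injective this) s
  obtain ⟨i, d, hd, L⟩ := K
  obtain ⟨i', d', hd', L'⟩ := K'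
  simp only [encodeState, List.cons.injEq] at hs
  have hi : i = i' := (bit_inj (hs i).1).1 rfl
  have hL : L = L' := by
    funext s; ext a
    have := (List.append_inj (hs s).2 (by simp)).1
    exact bit_inj (congrFun (List.ofFn_injective this) a)
  have hδ : d = d' := by
    funext s; ext t
    have := (List.append_inj (hs s).2 (by simp)).2
    exact bit_inj (congrFun (List.ofFn_injective this) t)
  subst hi hL hδ
  rfl

end KripkeStructure

/-- The model checking problem of a fixed formula, as a language: the codes of the finite Kripke
structures that satisfy it. -/
def HyperLTL.Formula.modelChecking {m : ℕ} (ψ : HyperLTL.Formula (Fin m)) : Language Bool :=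
  {w | ∃ (n : ℕ) (K : KripkeStructure (Fin n) (Fin m)), K.encode = w ∧ K.Satisfies ψ}

/-! ### Polynomial space -/

/-- A deterministic Turing machine with one tape that is infinite to the right, with finitely many
states and tape symbols and with input alphabet `A`. The machine halts in state `q` on symbol `a`
if `trans q a = none`. -/
structure SpaceTM (A : Type) where
  Q : Type
  Γ : Type
  [finQ : Finite Q]
  [finΓ : Finite Γ]
  blank : Γ
  input : A ↪ Γ
  input_ne_blank : ∀ a, input a ≠ blank
  start : Q
  accept : Set Q
  trans : Q → Γ → Option (Q × Γ × Turing.Dir)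

namespace SpaceTM

/-- A configuration: the state, the position of the head, and the content of the tape. -/
structure Cfg {A : Type} (M : SpaceTM A) where
  state : M.Q
  head : ℕ
  tape : ℕ → M.Γ

/-- The initial configuration on an input word: the head scans the first cell. -/
def initCfg {A : Type} (M : SpaceTM A) (w : List A) : M.Cfg where
  state := M.start
  head := 0
  tape i := (w[i]?).elim M.blank M.input

/-- One step: write, move, and change the state. A left move in cell `0` leaves the head there. -/
def step {A : Type} (M : SpaceTM A) (c : M.Cfg) : Option M.Cfg :=
  (M.trans c.state (c.tape c.head)).map fun r =>
    { state := r.1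
      head := match r.2.2 with
        | .left => c.head - 1
        | .right => c.head + 1
      tape := Function.update c.tape c.head r.2.1 }

/-- `M` decides `B` in space `s`: on every input `w` it only ever scans the first `s |w|` cells,
and it halts, in an accepting state exactly if `w ∈ B`. -/
def DecidesInSpace {A : Type} (M : SpaceTM A) (B : Language A) (s : ℕ → ℕ) : Prop :=
  ∀ w : List A,
    (∀ c, StateTransition.Reaches M.step (M.initCfg w) c → c.head < s w.length) ∧
    ∃ c, StateTransition.Reaches M.step (M.initCfg w) c ∧ M.step c = none ∧
      (c.state ∈ M.accept ↔ w ∈ B)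

end SpaceTM

/-- The class PSPACE: languages decided by a deterministic Turing machine in polynomial space. -/
def InPSPACE {A : Type} (B : Language A) : Prop :=
  ∃ (M : SpaceTM A) (p : Polynomial ℕ), M.DecidesInSpace B fun n => p.eval n

/-- Polynomial-time many-one reducibility. -/
def PolyTimeReducible {A A' : Type} (B : Language A) (B' : Language A') : Prop :=
  ∃ f : List A → List A',
    Nonempty (Turing.TM2ComputableInPolyTime (id : List A → List A) (id : List A' → List A') f) ∧
    ∀ w, w ∈ B ↔ f w ∈ B'

/-- PSPACE-hardness under polynomial-time many-one reductions. -/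
def PSPACEHard {A' : Type} (B' : Language A') : Prop :=
  ∀ (A : Type) [Finite A] (B : Language A), InPSPACE B → PolyTimeReducible B B'

/-! Let `M` decide a language in polynomial space. On an input of length `n` it is simulated on a
circular tape of `N` cells, with `N` polynomial in `n`, by a machine that obtains only one bit of
information about the tape per step. A Kripke structure cannot store the whole tape, but it can
follow a single cell: its first step picks the cell to watch, and from then on each state holds the
content of that cell, its distance from the head modulo `N`, the control state, and a freshly
guessed answer to the current query. This takes `N` times a constant number of states, plus the
initial one.

A trace shows the guessed answers through proposition `0`. Proposition `1` signals that the machine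
rejects or that the watched cell is being scanned and contradicts the guess. An answer sequence
determines the whole run, so traces with equal answers follow the same run and differ only in the
watched cell. Hence `∃ π₀. ∀ π₁`, "if the answers agree, proposition `1` never holds on `π₁`", says
that some answer sequence is confirmed by every cell and never leads to rejection. Only the correct
answers are confirmed, so the formula says that the correct run never rejects
(`BitMachine.satisfies_kripke`). As answers are single bits, two propositions serve all machines,
and the formula is independent of `M`; symbols are found by trying candidates
(`DecidesInSpace.rejects_iff`). Further alternations come from dummy quantifiers.

For computability, the new distance minus the old one depends only on the move of the head. The
adjacency matrix is therefore essentially block-circulant: each block row arises from one pattern by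
rotation, up to a modification at distance zero. A stack program writes it in polynomial time
(`computable_output`), and `output_spec` identifies the result with the code of the structure. -/

/-! ### A structured language over stacks and its compilation to `TM2` machines -/

open Turing

/-- Programs over a family of stacks. `pop k f` pops the stack `k` and continues according to the
result; `loop k f` pops `k` until it is empty and runs `f a` on each popped symbol `a`. -/
inductive StackProg {K : Type} (Γ : K → Type) : Type where
  | skip : StackProg Γ
  | push (k : K) (a : Γ k) : StackProg Γ
  | seq (c d : StackProg Γ) : StackProg Γ
  | pop (k : K) (f : Option (Γ k) → StackProg Γ) : StackProg Γ
  | loop (k : K) (f : Γ k → StackProg Γ) : StackProg Γ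

namespace StackProg

variable {K : Type} {Γ : K → Type}

/-- The control locations of a program, without the exit. -/
def Loc : StackProg Γ → Type
  | skip => Unit
  | push _ _ => Unit
  | seq c d => c.Loc ⊕ d.Loc
  | pop _ f => Option (Σ o, (f o).Loc)
  | loop _ f => Option (Σ a, (f a).Loc)

/-- The first control location of a program. -/
def entry : (c : StackProg Γ) → c.Loc
  | skip => ()
  | push _ _ => ()
  | seq c _ => Sum.inl c.entry
  | pop _ _ => none
  | loop _ _ => none

theorem finite_loc [∀ k, Finite (Γ k)] (c : StackProg Γ) : Finite c.Loc := by
  induction c with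
  | skip => exact inferInstanceAs (Finite Unit)
  | push => exact inferInstanceAs (Finite Unit)
  | seq c d hc hd => exact inferInstanceAs (Finite (c.Loc ⊕ d.Loc))
  | pop k f h => exact inferInstanceAs (Finite (Option (Σ o, (f o).Loc)))
  | loop k f h => exact inferInstanceAs (Finite (Option (Σ a, (f a).Loc)))

/-- The register of the compiled machine: the symbol popped last. -/
abbrev Reg (Γ : K → Type) : Type := Option (Σ k, Γ k)

variable [DecidableEq K]

/-- The content of the register, read as a symbol of the stack `k`. -/
def readReg (k : K) (v : Reg Γ) : Option (Γ k) :=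
  v.bind fun x => if h : x.1 = k then some (h ▸ x.2) else none

@[simp]
theorem readReg_map (k : K) (o : Option (Γ k)) :
    readReg k (o.map fun a => (⟨k, a⟩ : Σ k, Γ k)) = o := by
  cases o <;> simp [readReg]

/-- The statements of the compiled program, for an embedding of its locations into the labels of
a machine and a label to continue with at the end. -/
def compile {Λ : Type} : (c : StackProg Γ) → (c.Loc → Λ) → Λ → c.Loc → TM2.Stmt Γ Λ (Reg Γ)
  | skip, _, exit, _ => .goto fun _ => exit
  | push k a, _, exit, _ => .push k (fun _ => a) (.goto fun _ => exit)
  | seq c d, emb, _, .inl l => c.compile (fun l => emb (.inl l)) (emb (.inr d.entry)) l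
  | seq _ d, emb, exit, .inr l => d.compile (fun l => emb (.inr l)) exit l
  | pop k f, emb, _, none =>
      .pop k (fun _ o => o.map fun a => ⟨k, a⟩)
        (.goto fun v => emb (some ⟨readReg k v, (f (readReg k v)).entry⟩))
  | pop _ f, emb, exit, some ⟨o, l⟩ => (f o).compile (fun l => emb (some ⟨o, l⟩)) exit l
  | loop k f, emb, exit, none =>
      .pop k (fun _ o => o.map fun a => ⟨k, a⟩)
        (.goto fun v => (readReg k v).elim exit fun a => emb (some ⟨a, (f a).entry⟩))
  | loop _ f, emb, _, some ⟨a, l⟩ => (f a).compile (fun l => emb (some ⟨a, l⟩)) (emb none) l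

open Function in
/-- Big-step semantics: `Eval c s s' t` says that `c` takes the stacks `s` to the stacks `s'` in
at most `t` steps. -/
inductive Eval : StackProg Γ → (∀ k, List (Γ k)) → (∀ k, List (Γ k)) → ℕ → Prop
  | skip (s) : Eval skip s s 1
  | push (k a s) : Eval (push k a) s (update s k (a :: s k)) 1
  | seq {c d s s' s'' t t'} : Eval c s s' t → Eval d s' s'' t' → Eval (seq c d) s s'' (t + t')
  | pop {k f s s' t} : Eval (f (s k).head?) (update s k (s k).tail) s' t →
      Eval (pop k f) s s' (t + 1)
  | loop_nil {k f s} : s k = [] → Eval (loop k f) s s 1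
  | loop_cons {k f s s' s'' a l t t'} : s k = a :: l → Eval (f a) (update s k l) s' t →
      Eval (loop k f) s' s'' t' → Eval (loop k f) s s'' (t + t' + 1)
  | mono {c s s' t t'} : Eval c s s' t → t ≤ t' → Eval c s s' t'

/-- A `TM2` step executes the whole statement at a label. Iterating `flip bind` is the form in which
`EvalsTo` counts steps. -/
theorem iterate_step_label {Λ : Type} {M : Λ → TM2.Stmt Γ Λ (Reg Γ)} {l : Λ}
    {q : TM2.Stmt Γ Λ (Reg Γ)} (h : M l = q) (n : ℕ) (v : Reg Γ) (s : ∀ k, List (Γ k)) :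
    (flip bind (TM2.step M))^[n + 1] (some ⟨some l, v, s⟩) =
      (flip bind (TM2.step M))^[n] (some (TM2.stepAux q v s)) := by
  subst h
  rw [Function.iterate_succ_apply]
  rfl

/-- The compiled program simulates the big-step semantics. -/
theorem Eval.simulates {Λ : Type} {M : Λ → TM2.Stmt Γ Λ (Reg Γ)} {c : StackProg Γ}
    {s s' : ∀ k, List (Γ k)} {t : ℕ} (h : Eval c s s' t) :
    ∀ (emb : c.Loc → Λ) (exit : Λ), (∀ l, M (emb l) = c.compile emb exit l) → ∀ v,
      ∃ v', ∃ n ≤ t, (flip bind (TM2.step M))^[n] (some ⟨some (emb c.entry), v, s⟩) =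
        some ⟨some exit, v', s'⟩ := by
  induction h with
  | skip s =>
    intro emb exit hM v
    exact ⟨v, 1, le_rfl, iterate_step_label (hM ()) 0 v s⟩
  | push k a s =>
    intro emb exit hM v
    exact ⟨v, 1, le_rfl, iterate_step_label (hM ()) 0 v s⟩
  | @seq c d s s' s'' t t' _ _ ih₁ ih₂ =>
    intro emb exit hM v
    obtain ⟨v₁, n₁, hn₁, h₁⟩ := ih₁ (fun l => emb (.inl l)) (emb (.inr d.entry))
      (fun l => hM (.inl l)) v
    obtain ⟨v₂, n₂, hn₂, h₂⟩ := ih₂ (fun l => emb (.inr l)) exit (fun l => hM (.inr l)) v₁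
    refine ⟨v₂, n₂ + n₁, by omega, ?_⟩
    rw [Function.iterate_add_apply]
    exact (congrArg _ h₁).trans h₂
  | @pop k f s s' t _ ih =>
    intro emb exit hM v
    obtain ⟨v₁, n₁, hn₁, h₁⟩ := ih (fun l => emb (some ⟨_, l⟩)) exit
      (fun l => hM (some ⟨_, l⟩)) ((s k).head?.map fun a => ⟨k, a⟩)
    refine ⟨v₁, n₁ + 1, by omega, (iterate_step_label (hM none) n₁ v s).trans ?_⟩
    -- The type of the target location depends on the popped value, so the register cannot be
    -- rewritten in place; the value is generalized first.
    have e : ∀ o, o = (s k).head? → emb (some ⟨o, (f o).entry⟩) =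
        emb (some ⟨(s k).head?, (f (s k).head?).entry⟩) := by
      rintro _ rfl
      rfl
    refine Eq.trans ?_ h₁
    rw [← e _ (readReg_map k (s k).head?)]
    rfl
  | @loop_nil k f s hs =>
    intro emb exit hM v
    refine ⟨none, 1, le_rfl, (iterate_step_label (hM none) 0 v s).trans ?_⟩
    have : Function.update s k [] = s := by rw [← hs, Function.update_eq_self]
    simp [compile, hs, this, readReg]
  | @loop_cons k f s s' s'' a l t t' hs _ _ ih₁ ih₂ =>
    intro emb exit hM v
    obtain ⟨v₁, n₁, hn₁, h₁⟩ := ih₁ (fun l => emb (some ⟨_, l⟩)) (emb none)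
      (fun l => hM (some ⟨_, l⟩)) (some ⟨k, a⟩)
    obtain ⟨v₂, n₂, hn₂, h₂⟩ := ih₂ emb exit hM v₁
    refine ⟨v₂, n₂ + (n₁ + 1), by omega, ?_⟩
    rw [Function.iterate_add_apply]
    refine (congrArg _ ((iterate_step_label (hM none) n₁ v s).trans ?_)).trans h₂
    refine Eq.trans ?_ h₁
    have := readReg_map k (some a)
    simp only [Option.map_some] at this
    simp [compile, hs, this]
  | mono _ hle ih =>
    intro emb exit hM v
    obtain ⟨v', n, hn, h⟩ := ih emb exit hM v
    exact ⟨v', n, hn.trans hle, h⟩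

/-- The `TM2` machine of a program. -/
noncomputable def machine [Fintype K] [∀ k, Finite (Γ k)] (k₀ k₁ : K) (c : StackProg Γ) :
    FinTM2 where
  K := K
  k₀ := k₀
  k₁ := k₁
  Γ := Γ
  Λ := Option c.Loc
  main := some c.entry
  ΛFin := @Fintype.ofFinite _ (have := c.finite_loc; inferInstance)
  σ := Reg Γ
  initialState := none
  σFin := Fintype.ofFinite _
  Γk₀Fin := Fintype.ofFinite _
  m
    | none => .load (fun _ => none) .halt
    | some l => c.compile some none l

/-- A program that takes every input on the stack `k₀` to the output on `k₁`, with all other stacks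
empty before and after, in polynomial time shows that the function is computable in polynomial
time. -/
theorem computableInPolyTime [Fintype K] [∀ k, Finite (Γ k)] {k₀ k₁ : K} (c : StackProg Γ)
    (f : List (Γ k₀) → List (Γ k₁)) (p : Polynomial ℕ)
    (h : ∀ w, Eval c (Function.update (fun _ => []) k₀ w)
      (Function.update (fun _ => []) k₁ (f w)) (p.eval w.length)) :
    Nonempty (TM2ComputableInPolyTime id id f) := by
  refine ⟨{ tm := c.machine k₀ k₁, inputAlphabet := Equiv.refl _, outputAlphabet := Equiv.refl _,
            time := p + 1, outputsFun := fun w => Classical.choice ?_ }⟩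
  let M : Option c.Loc → TM2.Stmt Γ (Option c.Loc) (Reg Γ) := (c.machine k₀ k₁).m
  obtain ⟨v, n, hn, hv⟩ := (h w).simulates (M := M) some none (fun _ => rfl) none
  -- Mathlib's initial and halting stacks are defined by a case distinction with a type cast; here
  -- they become updates of the empty family.
  have e₀ : ∀ (k : K) (l l' : List (Γ k)), l = l' →
      (fun k' => @dite (List (Γ k')) (k' = k) (‹DecidableEq K› k' k)
        (fun h => by rw [h]; exact l) fun _ => []) = Function.update (fun _ => []) k l' := by
    rintro k l _ rfl
    funext k'
    by_cases hk : k' = k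
    · subst hk; simp
    · simp [hk]
  refine ⟨⟨⟨n + 1, ?_⟩, by simpa using hn⟩⟩
  have hs : (flip bind (TM2.step M))^[n + 1] (some ⟨some (some c.entry), none,
      Function.update (fun _ => []) k₀ w⟩) = some (⟨none, none,
      Function.update (fun _ => []) k₁ (f w)⟩ : TM2.Cfg Γ (Option c.Loc) (Reg Γ)) := by
    rw [Function.iterate_succ_apply', hv]
    rfl
  rw [← e₀ k₀ _ w (List.map_id w), ← e₀ k₁ _ (f w) (List.map_id _)] at hs
  exact hs

end StackProg

/-! ### A family of formulas -/

namespace HyperLTL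

/-- The formula `true`. -/
def Body.top : Body (Fin 2) := .or (.atom 0 0) (.neg (.atom 0 0))

/-- The traces `0` and `1` differ in the first letter on the proposition `0`. -/
def Body.differ : Body (Fin 2) :=
  .or (.neg (.or (.neg (.atom 0 0)) (.atom 0 1))) (.neg (.or (.neg (.atom 0 1)) (.atom 0 0)))

/-- If the traces `0` and `1` agree on the proposition `0` forever, then the proposition `1` never
holds on the trace `1`. -/
def Body.safeIfAgree : Body (Fin 2) :=
  .or (.untl .top .differ) (.neg (.untl .top (.atom 1 1)))

/-- `∃ π₀. ∀ π₁. safeIfAgree`, with `j` additional quantifiers in front that alternate. -/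
def Formula.hard : ℕ → Formula (Fin 2)
  | 0 => .ex 0 (.all 1 (.body .safeIfAgree))
  | j + 1 => if j % 2 = 0 then .all 2 (hard j) else .ex 2 (hard j)

theorem Formula.hard_closed (j : ℕ) : (hard j).Closed := by
  unfold Closed
  induction j with
  | zero =>
    ext x
    simp only [hard, freeVars, Body.safeIfAgree, Body.vars, Body.top, Body.differ, Set.mem_sdiff,
      Set.mem_union, Set.mem_singleton_iff, Set.mem_empty_iff_false]
    tauto
  | succ j ih =>
    rw [hard]
    split_ifs <;> simp [freeVars, ih]

/-- The parity of `j` determines the outermost quantifier, so the next one put in front always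
differs from it and adds one alternation. -/
theorem Formula.head?_quantifiers_hard (j : ℕ) :
    ∃ l, (hard j).quantifiers = (j % 2 == 0) :: l := by
  cases j with
  | zero => exact ⟨_, rfl⟩
  | succ j =>
    rw [hard]
    split_ifs with h
    · exact ⟨_, by rw [quantifiers]; simp [show (j + 1) % 2 = 1 by omega]; rfl⟩
    · exact ⟨_, by rw [quantifiers]; simp [show (j + 1) % 2 = 0 by omega]; rfl⟩

theorem Formula.alternations_hard (j : ℕ) : (hard j).alternations = j + 1 := by
  induction j with
  | zero => simp [hard, alternations, quantifiers]
  | succ j ih =>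
    obtain ⟨l, hl⟩ := head?_quantifiers_hard j
    have hq : (hard (j + 1)).quantifiers = (!(j % 2 == 0)) :: (hard j).quantifiers := by
      rw [hard]
      split_ifs with h
      · simp [quantifiers, h]
      · simp [quantifiers, h]
    unfold alternations at ih ⊢
    rw [hq, hl]
    rw [hl] at ih
    simp only [List.tail_cons, List.zip_cons_cons, List.countP_cons] at ih ⊢
    rw [ih]
    simp

theorem Assignment.suffix_apply {AP : Type*} (v : Assignment AP) (i π : ℕ) :
    v.suffix i π = (v π).map fun t j => t (i + j) := rfl

theorem Body.sat_safeIfAgree {v : Assignment (Fin 2)} {t t' : Trace (Fin 2)} (h₀ : v 0 = some t)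
    (h₁ : v 1 = some t') :
    safeIfAgree.Sat v ↔ ((∀ i, 0 ∈ t i ↔ 0 ∈ t' i) → ∀ i, 1 ∉ t' i) := by
  have htop : ∀ w, top.Sat w := fun w => by simp only [top, Sat]; tauto
  have hdiff : ∀ i, differ.Sat (v.suffix i) ↔ ¬ (0 ∈ t i ↔ 0 ∈ t' i) := fun i => by
    simp only [differ, Sat, Assignment.suffix_apply, h₀, h₁, Option.map_some, Option.some.injEq,
      exists_eq_left', Nat.add_zero]
    tauto
  simp only [safeIfAgree, Sat, htop, implies_true, and_true, hdiff, Assignment.suffix_apply, h₁,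
    Option.map_some, Option.some.injEq, exists_eq_left', Nat.add_zero, not_exists]
  rw [← not_forall, or_iff_not_imp_left, not_not]

/-- The additional quantifiers bind the variable `2`, which the body does not read; over a nonempty
trace set they are vacuous. -/
theorem Formula.sat_hard {T : Set (Trace (Fin 2))} (hT : T.Nonempty) (j : ℕ)
    (v : Assignment (Fin 2)) : (hard j).Sat T v ↔
      ∃ t ∈ T, ∀ t' ∈ T, (∀ i, 0 ∈ t i ↔ 0 ∈ t' i) → ∀ i, 1 ∉ t' i := by
  induction j generalizing v with
  | zero =>
    simp only [hard, Sat]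
    refine exists_congr fun t => and_congr_right fun _ => forall₂_congr fun t' _ => ?_
    exact Body.sat_safeIfAgree (by simp [Function.update]) (by simp)
  | succ j ih =>
    rw [hard]
    obtain ⟨t, ht⟩ := hT
    split_ifs
    · simp only [Sat, ih]
      exact ⟨fun h => h t ht, fun h _ _ => h⟩
    · simp only [Sat, ih]
      exact ⟨fun ⟨_, _, h⟩ => h, fun h => ⟨t, ht, h⟩⟩

end HyperLTL

/-! ### Machines that query their tape by bits -/

/-- A machine with cell contents `X` and control states `P` on a circular tape. In each step it asks
for one bit about the scanned cell; the bit determines the next control state, the new content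
of the cell, the move of the head, and whether the machine rejects. -/
structure BitMachine (X P : Type) where
  start : P
  query : P → X → Bool
  next : P → Bool → P
  write : P → Bool → X → X
  move : P → Bool → SignType
  rej : P → Bool → Prop

namespace BitMachine

variable {X P : Type} {N : ℕ} [NeZero N]

/-- A configuration on a circular tape with `N` cells. -/
@[ext]
structure Cfg (X P : Type) (N : ℕ) where
  control : P
  head : Fin N
  tape : Fin N → X

/-- The correct answer to the query of a configuration. -/
def answer (B : BitMachine X P) (c : Cfg X P N) : Bool := B.query c.control (c.tape c.head)

/-- The effect of an answer, correct or not. -/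
def step (B : BitMachine X P) (c : Cfg X P N) (b : Bool) : Cfg X P N where
  control := B.next c.control b
  head := c.head + (B.move c.control b : Fin N)
  tape := Function.update c.tape c.head (B.write c.control b (c.tape c.head))

/-- The run on given answers. -/
def run (B : BitMachine X P) (c : Cfg X P N) (b : ℕ → Bool) : ℕ → Cfg X P N
  | 0 => c
  | t + 1 => B.step (B.run c b t) (b t)

/-- The step with the correct answer. -/
def trueStep (B : BitMachine X P) (c : Cfg X P N) : Cfg X P N := B.step c (B.answer c)

/-- The machine rejects at some time of the run on correct answers. -/
def Rejects (B : BitMachine X P) (c : Cfg X P N) : Prop :=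
  ∃ t, B.rej (B.trueStep^[t] c).control (B.answer (B.trueStep^[t] c))

/-- The initial configuration. -/
def init (B : BitMachine X P) (W : Fin N → X) : Cfg X P N := ⟨B.start, 0, W⟩

theorem rejects_iff_of_not_rej (B : BitMachine X P) {c : Cfg X P N}
    (h : ¬ B.rej c.control (B.answer c)) : B.Rejects (B.trueStep c) ↔ B.Rejects c := by
  constructor
  · rintro ⟨t, ht⟩
    exact ⟨t + 1, by simpa only [Function.iterate_succ_apply] using ht⟩
  · rintro ⟨t, ht⟩
    cases t with
    | zero => exact (h ht).elim
    | succ t => exact ⟨t, by simpa only [Function.iterate_succ_apply] using ht⟩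

theorem rejects_iff_of_fixed (B : BitMachine X P) {c : Cfg X P N} (h : B.trueStep c = c) :
    B.Rejects c ↔ B.rej c.control (B.answer c) := by
  have : ∀ t, B.trueStep^[t] c = c := fun t => Function.iterate_fixed h t
  simp [Rejects, this]

/-- Answers that are never wrong are the answers of the correct run. -/
theorem run_eq_iterate (B : BitMachine X P) {c : Cfg X P N} {b : ℕ → Bool}
    (h : ∀ t, b t = B.answer (B.run c b t)) (t : ℕ) : B.run c b t = B.trueStep^[t] c := by
  induction t with
  | zero => rfl
  | succ t ih =>
    rw [Function.iterate_succ_apply', ← ih, run, h t, ← trueStep]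

/-- The left side is what the formula will express. Correct answers are determined step by step, so
the only candidate for `b` is the answer sequence of the correct run. -/
theorem exists_run_iff (B : BitMachine X P) (c : Cfg X P N) :
    (∃ b : ℕ → Bool, ∀ t, b t = B.answer (B.run c b t) ∧ ¬ B.rej (B.run c b t).control (b t)) ↔
      ¬ B.Rejects c := by
  simp only [Rejects, not_exists]
  constructor
  · rintro ⟨b, hb⟩ t
    have hr := B.run_eq_iterate (fun t => (hb t).1) t
    rw [← hr, ← (hb t).1]
    exact (hb t).2
  · intro h
    have hr : ∀ t, B.run c (fun t => B.answer (B.trueStep^[t] c)) t = B.trueStep^[t] c := by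
      intro t
      induction t with
      | zero => rfl
      | succ t ih => rw [Function.iterate_succ_apply', run, ih, ← trueStep]
    refine ⟨fun t => B.answer (B.trueStep^[t] c), fun t => ?_⟩
    rw [hr]
    exact ⟨rfl, h t⟩

/-- The local part of a state of the Kripke structure: the content of the watched cell, the
control state, and the guessed answer. -/
abbrev Loc (X P : Type) : Type := X × P × Bool

/-- The next content of the watched cell; `e` says that the head scans it. -/
def nextCell (B : BitMachine X P) (e : Bool) (r : Loc X P) : X :=
  if e then B.write r.2.1 r.2.2 r.1 else r.1

/-- The guessed answer is wrong for the watched cell, or the machine rejects. -/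
def Bad (B : BitMachine X P) (e : Bool) (r : Loc X P) : Prop :=
  (e = true ∧ r.2.2 ≠ B.query r.2.1 r.1) ∨ B.rej r.2.1 r.2.2

/-- The Kripke structure of the machine on an initial tape. Except in the initial state, it watches
one cell and stores the distance from the head to this cell. -/
def kripke (B : BitMachine X P) (W : Fin N → X) :
    KripkeStructure (Option (Fin N × Loc X P)) (Fin 2) where
  init := none
  δ s := {s' | ∃ d r, s' = some (d, r) ∧ match s with
    | none => r.1 = W d ∧ r.2.1 = B.start
    | some (d₀, r₀) => d = d₀ - (B.move r₀.2.1 r₀.2.2 : Fin N) ∧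
        r.1 = B.nextCell (d₀ == 0) r₀ ∧ r.2.1 = B.next r₀.2.1 r₀.2.2}
  δ_nonempty
    | none => ⟨some (0, W 0, B.start, true), 0, _, rfl, rfl, rfl⟩
    | some (d₀, r₀) => ⟨some (d₀ - (B.move r₀.2.1 r₀.2.2 : Fin N), B.nextCell (d₀ == 0) r₀,
        B.next r₀.2.1 r₀.2.2, true), _, _, rfl, rfl, rfl, rfl⟩
  L s := {a | ∃ d r, s = some (d, r) ∧
    ((a = 0 ∧ r.2.2 = true) ∨ (a = 1 ∧ B.Bad (d == 0) r))}

section kripke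

variable (B : BitMachine X P) (W : Fin N → X) (d d' : Fin N) (r r' : Loc X P)
  (s : Option (Fin N × Loc X P))

theorem none_notMem_δ_kripke : none ∉ (B.kripke W).δ s := by simp [kripke]

theorem mem_δ_kripke_none :
    some (d, r) ∈ (B.kripke W).δ none ↔ r.1 = W d ∧ r.2.1 = B.start := by
  refine ⟨?_, fun h => ⟨_, _, rfl, h⟩⟩
  rintro ⟨_, _, ⟨⟩, h⟩
  exact h

theorem mem_δ_kripke_some :
    some (d', r') ∈ (B.kripke W).δ (some (d, r)) ↔
      d' = d - (B.move r.2.1 r.2.2 : Fin N) ∧ r'.1 = B.nextCell (d == 0) r ∧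
        r'.2.1 = B.next r.2.1 r.2.2 := by
  refine ⟨?_, fun h => ⟨_, _, rfl, h⟩⟩
  rintro ⟨_, _, ⟨⟩, h⟩
  exact h

theorem L_kripke_none : (B.kripke W).L none = ∅ := by simp [kripke]

theorem zero_mem_L_kripke : 0 ∈ (B.kripke W).L (some (d, r)) ↔ r.2.2 = true := by
  refine ⟨?_, fun h => ⟨_, _, rfl, .inl ⟨rfl, h⟩⟩⟩
  rintro ⟨_, _, ⟨⟩, ⟨_, h⟩ | ⟨h, _⟩⟩
  · exact h
  · simp at h

theorem one_mem_L_kripke : 1 ∈ (B.kripke W).L (some (d, r)) ↔ B.Bad (d == 0) r := by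
  refine ⟨?_, fun h => ⟨_, _, rfl, .inr ⟨rfl, h⟩⟩⟩
  rintro ⟨_, _, ⟨⟩, ⟨h, _⟩ | ⟨_, h⟩⟩
  · simp at h
  · exact h

end kripke

/-- The state reached at time `t + 1` if the cell `i` is watched. -/
def watch (B : BitMachine X P) (W : Fin N → X) (i : Fin N) (b : ℕ → Bool) (t : ℕ) :
    Fin N × Loc X P :=
  (i - (B.run (B.init W) b t).head, (B.run (B.init W) b t).tape i,
    (B.run (B.init W) b t).control, b t)

/-- A step changes only the scanned cell, and the watched cell is scanned exactly when its distance
is zero. So watching one cell needs no knowledge of the others. -/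
theorem nextCell_watch (B : BitMachine X P) (W : Fin N → X) (i : Fin N) (b : ℕ → Bool) (t : ℕ) :
    B.nextCell ((B.watch W i b t).1 == 0) (B.watch W i b t).2 =
      (B.run (B.init W) b (t + 1)).tape i := by
  by_cases h : i = (B.run (B.init W) b t).head
  · have h' : (B.watch W i b t).1 = 0 := by simp [watch, ← h]
    simp only [nextCell, h', run, step]
    simp [watch, ← h]
  · have h' : (B.watch W i b t).1 ≠ 0 := by simpa [watch, sub_eq_zero] using h
    simp only [nextCell, beq_iff_eq, h', if_false, run, step]
    simp [watch, h]

/-- After the choice of the watched cell, only the guessed answers are free and everything else in a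
state is forced. A path thus amounts to a cell `i` and an answer sequence `b`. -/
theorem mem_traces_kripke (B : BitMachine X P) (W : Fin N → X) (t : HyperLTL.Trace (Fin 2)) :
    t ∈ (B.kripke W).traces ↔ ∃ i b, t 0 = ∅ ∧
      ∀ n, t (n + 1) = (B.kripke W).L (some (B.watch W i b n)) := by
  have h0 := B.L_kripke_none W
  constructor
  · rintro ⟨p, hp, hδ, ht⟩
    obtain ⟨i, r, hi, hr, hr'⟩ : ∃ d r, p 1 = some (d, r) ∧ r.1 = W d ∧ r.2.1 = B.start := by
      have := hδ 0
      rw [hp] at this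
      exact this
    -- The default `false` is never used: no path returns to the initial state.
    let b : ℕ → Bool := fun n => (p (n + 1)).elim false fun s => s.2.2.2
    have key : ∀ n, p (n + 1) = some (B.watch W i b n) := by
      intro n
      induction n with
      | zero =>
        have hb : b 0 = r.2.2 := by simp [b, hi]
        rw [hi]
        simp [watch, run, init, hb, ← hr, ← hr']
      | succ n ih =>
        obtain ⟨d, r₁, h₁, h₂, h₃, h₄⟩ : ∃ d r, p (n + 1 + 1) = some (d, r) ∧
            d = (B.watch W i b n).1 - (B.move (B.watch W i b n).2.2.1
              (B.watch W i b n).2.2.2 : Fin N) ∧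
            r.1 = B.nextCell ((B.watch W i b n).1 == 0) (B.watch W i b n).2 ∧
            r.2.1 = B.next (B.watch W i b n).2.2.1 (B.watch W i b n).2.2.2 := by
          have := hδ (n + 1)
          rw [ih] at this
          exact this
        have hb : b (n + 1) = r₁.2.2 := by simp [b, h₁]
        rw [nextCell_watch] at h₃
        rw [h₁]
        simp only [watch, hb, h₂, run, step, sub_sub, Option.some.injEq, Prod.mk.injEq, true_and]
        refine Prod.ext h₃ (Prod.ext h₄ rfl)
    refine ⟨i, b, by rw [ht, hp, ← h0]; rfl, fun n => by rw [ht, key]⟩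
  · rintro ⟨i, b, ht0, ht⟩
    refine ⟨fun n => n.casesOn none fun n => some (B.watch W i b n), rfl, fun n => ?_, fun n => ?_⟩
    · cases n with
      | zero => exact ⟨_, _, rfl, by simp [run, init], by simp [run, init]⟩
      | succ n =>
        refine ⟨_, _, rfl, ?_, ?_, ?_⟩
        · simp [run, step, sub_sub]
        · exact (nextCell_watch B W i b n).symm
        · rfl
    · cases n with
      | zero => exact ht0.trans h0.symm
      | succ n => exact ht n

theorem traces_nonempty {S AP : Type*} (K : KripkeStructure S AP) : K.traces.Nonempty := by
  choose f hf using K.δ_nonempty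
  exact ⟨_, fun n => f^[n] K.init, rfl,
    fun n => by simpa only [Function.iterate_succ_apply'] using hf _, fun _ => rfl⟩

/-- The Kripke structure satisfies the formula if and only if the machine never rejects. -/
theorem satisfies_kripke (B : BitMachine X P) (W : Fin N → X) (j : ℕ) :
    (B.kripke W).Satisfies (HyperLTL.Formula.hard j) ↔ ¬ B.Rejects (B.init W) := by
  have hL0 : ∀ s : Fin N × Loc X P, (0 : Fin 2) ∈ (B.kripke W).L (some s) ↔ s.2.2.2 = true :=
    fun s => B.zero_mem_L_kripke W s.1 s.2
  have hL1 : ∀ s : Fin N × Loc X P,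
      (1 : Fin 2) ∈ (B.kripke W).L (some s) ↔ B.Bad (s.1 == 0) s.2 :=
    fun s => B.one_mem_L_kripke W s.1 s.2
  rw [KripkeStructure.Satisfies, HyperLTL.Formula.sat_hard (traces_nonempty _),
    ← exists_run_iff]
  have trace : ∀ i b, ∃ t ∈ (B.kripke W).traces, t 0 = ∅ ∧
      ∀ n, t (n + 1) = (B.kripke W).L (some (B.watch W i b n)) := fun i b =>
    ⟨fun n => n.casesOn ∅ fun n => (B.kripke W).L (some (B.watch W i b n)),
      (mem_traces_kripke B W _).2 ⟨i, b, rfl, fun _ => rfl⟩, rfl, fun _ => rfl⟩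
  constructor
  · rintro ⟨t, ht, h⟩
    obtain ⟨i, b, ht0, ht⟩ := (mem_traces_kripke B W _).1 ht
    -- The universal quantifier is applied to the traces with the same answers and every possible
    -- watched cell.
    have good : ∀ i' n, ¬ B.Bad ((B.watch W i' b n).1 == 0) (B.watch W i' b n).2 := by
      intro i' n
      obtain ⟨t', ht'T, ht'0, ht'⟩ := trace i' b
      have := h t' ht'T (fun n => by
        cases n with
        | zero => rw [ht0, ht'0]
        | succ n => rw [ht, ht', hL0, hL0]; rfl) (n + 1)
      rwa [ht', hL1] at this
    refine ⟨b, fun n => ?_⟩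
    -- Watching the cell scanned at time `n` tests the answer given at time `n`.
    have := good (B.run (B.init W) b n).head n
    simpa [Bad, watch, answer] using this
  · rintro ⟨b, hb⟩
    -- Any watched cell would do, since proposition `0` shows only the answers.
    obtain ⟨t, ht, ht0, htn⟩ := trace 0 b
    refine ⟨t, ht, fun t' ht' h n => ?_⟩
    obtain ⟨i, b', ht'0, ht'⟩ := (mem_traces_kripke B W _).1 ht'
    have hbb : b = b' := by
      funext n
      have := h (n + 1)
      rw [htn, ht', hL0, hL0] at this
      exact Bool.eq_iff_iff.2 this
    subst hbb
    cases n with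
    | zero => simp [ht'0]
    | succ n =>
      rw [ht', hL1]
      rintro (⟨he, hne⟩ | hr)
      · refine hne ((hb n).1.trans ?_)
        have : i = (B.run (B.init W) b n).head := by simpa [watch, sub_eq_zero] using he
        simp [watch, answer, ← this]
      · exact (hb n).2 hr

end BitMachine

/-! ### Simulation of space-bounded Turing machines -/

/-- A cyclic permutation. It lets the simulating machine run through all candidates for the scanned
cell from any starting point. -/
theorem exists_transitive_map (X : Type) [Finite X] :
    ∃ f : X → X, ∀ x y, ∃ j, f^[j] x = y := by
  obtain ⟨n, ⟨e⟩⟩ := Finite.exists_equiv_fin X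
  cases n with
  | zero => exact ⟨id, fun x => (e x).elim0⟩
  | succ n =>
    have key : ∀ (j : ℕ) x, (fun x => e.symm (e x + 1))^[j] x = e.symm (e x + Fin.ofNat (n + 1) j) := by
      intro j x
      induction j with
      | zero => simp
      | succ j ih =>
        rw [Function.iterate_succ_apply', ih]
        simp only [Equiv.apply_symm_apply, add_assoc]
        congr 2
        ext
        simp [Fin.val_add]
    refine ⟨fun x => e.symm (e x + 1), fun x y => ⟨(e y - e x).val, ?_⟩⟩
    rw [key]
    simp

namespace SpaceTM

variable {A : Type} (M : SpaceTM A)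

/-- The cells of the simulating machine: a tape symbol and a mark for the first cell. -/
abbrev Cell : Type := M.Γ × Bool

open Classical in
/-- The machine that simulates `M`. Its control state is a state of `M` and a candidate for the
scanned cell; it asks whether the candidate is right and tries the next one if it is not. -/
noncomputable def toBitMachine (f : M.Cell → M.Cell) : BitMachine M.Cell (M.Q × M.Cell) where
  start := (M.start, (M.blank, false))
  query p x := decide (x = p.2)
  next p b := if b then (M.trans p.1 p.2.1).elim p fun r => (r.1, p.2) else (p.1, f p.2)
  write p b x := if b then (M.trans p.1 p.2.1).elim x fun r => (r.2.1, x.2) else x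
  move p b :=
    if b then
      (M.trans p.1 p.2.1).elim 0 fun r => match r.2.2 with
        | .left => if p.2.2 then 0 else -1
        | .right => 1
    else 0
  rej p b := b = true ∧ M.trans p.1 p.2.1 = none ∧ p.1 ∉ M.accept

variable {M} {N : ℕ} [NeZero N] {f : M.Cell → M.Cell}

/-- The representation of a configuration, for a candidate for the scanned cell. -/
def rep (N : ℕ) [NeZero N] (c : M.Cfg) (x : M.Cell) : BitMachine.Cfg M.Cell (M.Q × M.Cell) N where
  control := (c.state, x)
  head := Fin.ofNat N c.head
  tape i := (c.tape i, i == 0)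

/-- The scanned cell, as a cell of the simulating machine. -/
def scanned (c : M.Cfg) : M.Cell := (c.tape c.head, c.head == 0)

/-- The bound on the head excludes wrapping around, so the mark is seen exactly in cell `0`. -/
theorem tape_rep {c : M.Cfg} (h : c.head < N) (x : M.Cell) :
    (rep N c x).tape (rep N c x).head = scanned c := by
  have h0 : (Fin.ofNat N c.head = 0) ↔ c.head = 0 := by
    rw [Fin.ext_iff]
    simp [Nat.mod_eq_of_lt h]
  have : (Fin.ofNat N c.head == 0) = (c.head == 0) := by
    rw [Bool.eq_iff_iff, beq_iff_eq, beq_iff_eq, h0]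
  simp only [rep, scanned, this, Fin.val_ofNat, Nat.mod_eq_of_lt h]

theorem answer_rep {c : M.Cfg} (h : c.head < N) (x : M.Cell) :
    (M.toBitMachine f).answer (rep N c x) = true ↔ scanned c = x := by
  rw [BitMachine.answer, tape_rep h]
  simp [toBitMachine, rep]

theorem trueStep_rep_of_ne {c : M.Cfg} (h : c.head < N) {x : M.Cell} (hx : scanned c ≠ x) :
    (M.toBitMachine f).trueStep (rep N c x) = rep N c (f x) := by
  have : (M.toBitMachine f).answer (rep N c x) = false := by
    rw [← Bool.not_eq_true, answer_rep h]; exact hx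
  rw [BitMachine.trueStep, this]
  simp [BitMachine.step, toBitMachine, rep]

/-- The candidate is irrelevant. -/
theorem rejects_rep_iff (hf : ∀ x y, ∃ j, f^[j] x = y) {c : M.Cfg} (h : c.head < N) (x : M.Cell) :
    (M.toBitMachine f).Rejects (rep N c x) ↔ (M.toBitMachine f).Rejects (rep N c (scanned c)) := by
  obtain ⟨j, hj⟩ := hf x (scanned c)
  induction j generalizing x with
  | zero => rw [← hj]; rfl
  | succ j ih =>
    by_cases hx : scanned c = x
    · rw [hx]
    · rw [← ih _ hj, ← trueStep_rep_of_ne h hx]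
      -- A wrong candidate receives the answer "no", on which the machine never rejects.
      refine (BitMachine.rejects_iff_of_not_rej _ ?_).symm
      simp only [toBitMachine, not_and]
      exact fun ha => absurd ((answer_rep h x).1 ha) hx

/-- With the right candidate, a halting configuration is a fixed point of the simulation, so
rejection is decided on the spot. -/
theorem rejects_rep_of_halt {c : M.Cfg} (h : c.head < N) (hs : M.step c = none) :
    (M.toBitMachine f).Rejects (rep N c (scanned c)) ↔ c.state ∉ M.accept := by
  have ht : M.trans c.state (c.tape c.head) = none := by simpa [step] using hs
  have ha := (answer_rep (f := f) h (scanned c)).2 rfl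
  rw [BitMachine.rejects_iff_of_fixed, ha]
  · simp [toBitMachine, rep, scanned, ht]
  · rw [BitMachine.trueStep, ha]
    refine BitMachine.Cfg.ext ?_ ?_ ?_
    · simp [BitMachine.step, toBitMachine, rep, scanned, ht]
    · simp [BitMachine.step, toBitMachine, rep, scanned, ht]
    · simp only [BitMachine.step]
      convert Function.update_eq_self (rep N c (scanned c)).head (rep N c (scanned c)).tape using 2
      simp [toBitMachine, rep, scanned, ht]

theorem rejects_rep_of_step (hf : ∀ x y, ∃ j, f^[j] x = y) {c c' : M.Cfg} (h : c.head < N)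
    (h' : c'.head < N) (hs : M.step c = some c') :
    (M.toBitMachine f).Rejects (rep N c (scanned c)) ↔
      (M.toBitMachine f).Rejects (rep N c' (scanned c')) := by
  obtain ⟨⟨q, a, d⟩, ht, rfl⟩ := Option.map_eq_some_iff.1 hs
  have ha := (answer_rep (f := f) h (scanned c)).2 rfl
  have hsucc : ∀ n, Fin.ofNat N n + 1 = Fin.ofNat N (n + 1) := fun n => by
    ext
    simp [Fin.val_add]
  -- The simulated step keeps the old candidate, which may be wrong for the new cell; the candidate
  -- being irrelevant, this does no harm.
  rw [← rejects_rep_iff hf h' (scanned c), ← BitMachine.rejects_iff_of_not_rej]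
  · rw [BitMachine.trueStep, ha]
    have htape := tape_rep h (scanned c)
    refine iff_of_eq (congrArg _ (BitMachine.Cfg.ext ?_ ?_ ?_))
    · simp [BitMachine.step, toBitMachine, rep, scanned, ht]
    · cases d with
      | right => simp [BitMachine.step, toBitMachine, rep, scanned, ht, hsucc,
          -Fin.ofNat_eq_cast]
      | left =>
        -- In cell `0` the mark suppresses the left move, which would otherwise wrap around the
        -- circular tape.
        by_cases h0 : c.head = 0
        · rw [h0] at ht
          simp [BitMachine.step, toBitMachine, rep, scanned, ht, h0]
        · obtain ⟨n, hn⟩ := Nat.exists_eq_succ_of_ne_zero h0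
          rw [hn] at ht
          simp [BitMachine.step, toBitMachine, rep, scanned, ht, hn, ← hsucc,
            -Fin.ofNat_eq_cast]
    · funext i
      simp only [BitMachine.step]
      by_cases hi : i = Fin.ofNat N c.head
      · have hi' : (i : ℕ) = c.head := by rw [hi]; exact Nat.mod_eq_of_lt h
        have : i = (rep N c (scanned c)).head := hi
        rw [this, Function.update_self, htape, ← this]
        have h0 : (c.head == 0) = (i == 0) := by
          rw [Bool.eq_iff_iff, beq_iff_eq, beq_iff_eq, ← hi', Fin.ext_iff]; rfl
        simp [toBitMachine, rep, scanned, ht, hi', h0]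
      · have hi' : (i : ℕ) ≠ c.head := by
          intro hi'
          exact hi (Fin.ext (hi'.trans (Nat.mod_eq_of_lt h).symm))
        rw [Function.update_of_ne (by exact hi)]
        simp [rep, hi']
  · simp [toBitMachine, rep, scanned, ht]

/-- The initial tape of the simulating machine. -/
def initTape (M : SpaceTM A) (N : ℕ) [NeZero N] (w : List A) (i : Fin N) : M.Cell :=
  ((w[(i : ℕ)]?).elim M.blank M.input, i == 0)

/-- Rejection is invariant along the run of `M`, hence can be read off at its halting configuration.
Extra cells do not matter. -/
theorem DecidesInSpace.rejects_iff {L : Language A} {s : ℕ → ℕ} (hM : M.DecidesInSpace L s)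
    (hf : ∀ x y, ∃ j, f^[j] x = y) {w : List A} (hN : s w.length ≤ N) :
    (M.toBitMachine f).Rejects ((M.toBitMachine f).init (M.initTape N w)) ↔ w ∉ L := by
  obtain ⟨hspace, c, hc, hhalt, hacc⟩ := hM w
  have hlt : ∀ c, StateTransition.Reaches M.step (M.initCfg w) c → c.head < N := fun c hc =>
    (hspace c hc).trans_le hN
  have hinit : (M.toBitMachine f).init (M.initTape N w) =
      rep N (M.initCfg w) (M.blank, false) := by
    ext <;> rfl
  have key : ∀ c, StateTransition.Reaches M.step (M.initCfg w) c →
      ((M.toBitMachine f).Rejects (rep N (M.initCfg w) (scanned (M.initCfg w))) ↔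
        (M.toBitMachine f).Rejects (rep N c (scanned c))) := by
    intro c hc
    induction hc with
    | refl => rfl
    | tail hb hstep ih =>
      exact ih.trans (rejects_rep_of_step hf (hlt _ hb) (hlt _ (hb.tail hstep)) hstep)
  rw [hinit, rejects_rep_iff hf (hlt _ .refl), key c hc, rejects_rep_of_halt (hlt c hc) hhalt, hacc]

end SpaceTM

/-! ### A program that writes block-circulant matrices -/

/-- Functions that agree with a polynomial. -/
def NatPoly (t : ℕ → ℕ) : Prop := ∃ q : Polynomial ℕ, ∀ n, t n = q.eval n

namespace NatPoly

protected theorem const (a : ℕ) : NatPoly fun _ => a := ⟨Polynomial.C a, by simp⟩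

protected theorem id : NatPoly fun n => n := ⟨Polynomial.X, by simp⟩

protected theorem add {t u : ℕ → ℕ} (ht : NatPoly t) (hu : NatPoly u) : NatPoly fun n => t n + u n := by
  obtain ⟨p, hp⟩ := ht
  obtain ⟨q, hq⟩ := hu
  exact ⟨p + q, by simp [hp, hq]⟩

protected theorem mul {t u : ℕ → ℕ} (ht : NatPoly t) (hu : NatPoly u) : NatPoly fun n => t n * u n := by
  obtain ⟨p, hp⟩ := ht
  obtain ⟨q, hq⟩ := hu
  exact ⟨p * q, by simp [hp, hq]⟩

protected theorem pow {t : ℕ → ℕ} (ht : NatPoly t) (e : ℕ) : NatPoly fun n => t n ^ e := by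
  obtain ⟨p, hp⟩ := ht
  exact ⟨p ^ e, by simp [hp]⟩

end NatPoly

namespace MatrixWriter

open StackProg

/-- The stacks of the program. -/
inductive Stk where
  | inp | out | acc | tape | tape' | pat | pat' | word | cnt | cnt' | un | un'
  deriving DecidableEq

instance : Fintype Stk :=
  Fintype.ofList [.inp, .out, .acc, .tape, .tape', .pat, .pat', .word, .cnt, .cnt', .un, .un'] <| by
    rintro ⟨⟩ <;> simp

/-- The alphabets of the stacks. -/
@[reducible]
def Sym (A X Y : Type) : Stk → Type
  | .inp => A
  | .out => Bool
  | .acc => Bool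
  | .tape => X
  | .tape' => X
  | .pat => Y
  | .pat' => Y
  | .word => A
  | .cnt => Unit
  | .cnt' => Unit
  | .un => Unit
  | .un' => Unit

instance {A X Y : Type} [Finite A] [Finite X] [Finite Y] (k : Stk) : Finite (Sym A X Y k) := by
  cases k <;> infer_instance

/-- The contents of the stacks. -/
structure Store (A X Y : Type) where
  inp : List A
  out : List Bool
  acc : List Bool
  tape : List X
  tape' : List X
  pat : List Y
  pat' : List Y
  word : List A
  cnt : List Unit
  cnt' : List Unit
  un : List Unit
  un' : List Unit

variable {A X Y : Type}

/-- The content of a stack. -/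
def Store.get (s : Store A X Y) : ∀ k, List (Sym A X Y k)
  | .inp => s.inp
  | .out => s.out
  | .acc => s.acc
  | .tape => s.tape
  | .tape' => s.tape'
  | .pat => s.pat
  | .pat' => s.pat'
  | .word => s.word
  | .cnt => s.cnt
  | .cnt' => s.cnt'
  | .un => s.un
  | .un' => s.un'

/-- Replace the content of a stack. -/
def Store.set (s : Store A X Y) : ∀ k, List (Sym A X Y k) → Store A X Y
  | .inp, l => { s with inp := l }
  | .out, l => { s with out := l }
  | .acc, l => { s with acc := l }
  | .tape, l => { s with tape := l }
  | .tape', l => { s with tape' := l }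
  | .pat, l => { s with pat := l }
  | .pat', l => { s with pat' := l }
  | .word, l => { s with word := l }
  | .cnt, l => { s with cnt := l }
  | .cnt', l => { s with cnt' := l }
  | .un, l => { s with un := l }
  | .un', l => { s with un' := l }

/-- This turns updates of a dependent family into record updates, which `simp` can compute. -/
theorem Store.get_set (s : Store A X Y) (k : Stk) (l : List (Sym A X Y k)) :
    (s.set k l).get = Function.update s.get k l := by
  funext k'
  cases k <;> cases k' <;> rfl

/-- Programs over the stacks. -/
abbrev Prog (A X Y : Type) : Type := StackProg (Sym A X Y)

/-- Big-step semantics on stores. -/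
def Run (c : Prog A X Y) (s s' : Store A X Y) (t : ℕ) : Prop := Eval c s.get s'.get t

namespace Run

variable {s s' s'' : Store A X Y} {t t' : ℕ} {k : Stk}

theorem mono {c : Prog A X Y} (h : Run c s s' t) (ht : t ≤ t') : Run c s s' t' := Eval.mono h ht

theorem of_eq {c : Prog A X Y} (h : Run c s s' t) (hs : s' = s'') (ht : t ≤ t') :
    Run c s s'' t' := by
  subst hs
  exact h.mono ht

theorem skip : Run (.skip : Prog A X Y) s s 1 := Eval.skip _

theorem push (k : Stk) (a : Sym A X Y k) : Run (.push k a) s (s.set k (a :: s.get k)) 1 := by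
  unfold Run
  rw [Store.get_set]
  exact Eval.push k a _

theorem seq {c d : Prog A X Y} (h : Run c s s' t) (h' : Run d s' s'' t') :
    Run (.seq c d) s s'' (t + t') := Eval.seq h h'

theorem pop {f : Option (Sym A X Y k) → Prog A X Y}
    (h : Run (f (s.get k).head?) (s.set k (s.get k).tail) s' t) : Run (.pop k f) s s' (t + 1) := by
  unfold Run at h
  rw [Store.get_set] at h
  exact Eval.pop h

theorem loop_nil {f : Sym A X Y k → Prog A X Y} (h : s.get k = []) : Run (.loop k f) s s 1 :=
  Eval.loop_nil h

theorem loop_cons {f : Sym A X Y k → Prog A X Y} {a : Sym A X Y k} {l : List (Sym A X Y k)}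
    (h : s.get k = a :: l) (h₁ : Run (f a) (s.set k l) s' t) (h₂ : Run (.loop k f) s' s'' t') :
    Run (.loop k f) s s'' (t + t' + 1) := by
  unfold Run at h₁
  rw [Store.get_set] at h₁
  exact Eval.loop_cons h h₁ h₂

end Run

/-- Push the symbols of a list in order. -/
def pushes (k : Stk) : List (Sym A X Y k) → Prog A X Y
  | [] => .skip
  | a :: l => .seq (.push k a) (pushes k l)

/-- The output is collected in reverse on `acc`; the final `flush` restores its order. -/
theorem run_pushes_acc (l : List Bool) (s : Store A X Y) :
    Run (pushes .acc l) s { s with acc := l.reverse ++ s.acc } (l.length + 1) := by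
  induction l generalizing s with
  | nil => exact Run.skip
  | cons a l ih =>
    refine ((Run.push .acc a).seq (ih _)).of_eq ?_ ?_
    · simp [Store.set, Store.get]
    · simp; omega

/-- Empty the stack `cnt`. -/
def clearCnt : Prog A X Y := .loop .cnt fun _ => .skip

theorem run_clearCnt (l : List Unit) (s : Store A X Y) (h : s.cnt = l) :
    Run clearCnt s { s with cnt := [] } (2 * l.length + 1) := by
  induction l generalizing s with
  | nil => exact (Run.loop_nil (k := .cnt) h).of_eq (by cases s; cases h; simp) (by simp)
  | cons a l ih =>
    refine (Run.loop_cons (k := .cnt) h Run.skip (ih _ rfl)).of_eq ?_ ?_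
    · simp [Store.set]
    · simp; omega

/-- Empty the stack `pat`. -/
def clearPat : Prog A X Y := .loop .pat fun _ => .skip

theorem run_clearPat (l : List Y) (s : Store A X Y) (h : s.pat = l) :
    Run clearPat s { s with pat := [] } (2 * l.length + 1) := by
  induction l generalizing s with
  | nil => exact (Run.loop_nil (k := .pat) h).of_eq (by cases s; cases h; simp) (by simp)
  | cons a l ih =>
    refine (Run.loop_cons (k := .pat) h Run.skip (ih _ rfl)).of_eq ?_ ?_
    · simp [Store.set]
    · simp; omega

/-- Move the stack `acc` to `out`. -/
def flush : Prog A X Y := .loop .acc fun a => .push .out a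

theorem run_flush (l : List Bool) (s : Store A X Y) (h : s.acc = l) :
    Run flush s { s with acc := [], out := l.reverse ++ s.out } (2 * l.length + 1) := by
  induction l generalizing s with
  | nil => exact (Run.loop_nil (k := .acc) h).of_eq (by cases s; cases h; simp) (by simp)
  | cons a l ih =>
    refine (Run.loop_cons (k := .acc) h (Run.push .out a) (ih _ rfl)).of_eq ?_ ?_
    · simp [Store.set, Store.get]
    · simp; omega

/-- Move the stack `tape'` to `tape`. -/
def restoreTape : Prog A X Y := .loop .tape' fun a => .push .tape a

theorem run_restoreTape (l : List X) (s : Store A X Y) (h : s.tape' = l) :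
    Run restoreTape s { s with tape' := [], tape := l.reverse ++ s.tape } (2 * l.length + 1) := by
  induction l generalizing s with
  | nil => exact (Run.loop_nil (k := .tape') h).of_eq (by cases s; cases h; simp) (by simp)
  | cons a l ih =>
    refine (Run.loop_cons (k := .tape') h (Run.push .tape a) (ih _ rfl)).of_eq ?_ ?_
    · simp [Store.set, Store.get]
    · simp; omega

/-- Move the stack `pat'` to `pat`. -/
def restorePat : Prog A X Y := .loop .pat' fun a => .push .pat a

theorem run_restorePat (l : List Y) (s : Store A X Y) (h : s.pat' = l) :
    Run restorePat s { s with pat' := [], pat := l.reverse ++ s.pat } (2 * l.length + 1) := by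
  induction l generalizing s with
  | nil => exact (Run.loop_nil (k := .pat') h).of_eq (by cases s; cases h; simp) (by simp)
  | cons a l ih =>
    refine (Run.loop_cons (k := .pat') h (Run.push .pat a) (ih _ rfl)).of_eq ?_ ?_
    · simp [Store.set, Store.get]
    · simp; omega

/-- Move the stack `pat` to `pat'`. -/
def savePat : Prog A X Y := .loop .pat fun a => .push .pat' a

theorem run_savePat (l : List Y) (s : Store A X Y) (h : s.pat = l) :
    Run savePat s { s with pat := [], pat' := l.reverse ++ s.pat' } (2 * l.length + 1) := by
  induction l generalizing s with
  | nil => exact (Run.loop_nil (k := .pat) h).of_eq (by cases s; cases h; simp) (by simp)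
  | cons a l ih =>
    refine (Run.loop_cons (k := .pat) h (Run.push .pat' a) (ih _ rfl)).of_eq ?_ ?_
    · simp [Store.set, Store.get]
    · simp; omega

/-- Move the stack `un` to `un'`. -/
def saveUn : Prog A X Y := .loop .un fun a => .push .un' a

theorem run_saveUn (l : List Unit) (s : Store A X Y) (h : s.un = l) :
    Run saveUn s { s with un := [], un' := l.reverse ++ s.un' } (2 * l.length + 1) := by
  induction l generalizing s with
  | nil => exact (Run.loop_nil (k := .un) h).of_eq (by cases s; cases h; simp) (by simp)
  | cons a l ih =>
    refine (Run.loop_cons (k := .un) h (Run.push .un' a) (ih _ rfl)).of_eq ?_ ?_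
    · simp [Store.set, Store.get]
    · simp; omega

/-- Move the stack `cnt'` to `cnt`. -/
def restoreCnt : Prog A X Y := .loop .cnt' fun a => .push .cnt a

theorem run_restoreCnt (l : List Unit) (s : Store A X Y) (h : s.cnt' = l) :
    Run restoreCnt s { s with cnt' := [], cnt := l.reverse ++ s.cnt } (2 * l.length + 1) := by
  induction l generalizing s with
  | nil => exact (Run.loop_nil (k := .cnt') h).of_eq (by cases s; cases h; simp) (by simp)
  | cons a l ih =>
    refine (Run.loop_cons (k := .cnt') h (Run.push .cnt a) (ih _ rfl)).of_eq ?_ ?_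
    · simp [Store.set, Store.get]
    · simp; omega

/-- Move the stack `cnt` to `cnt'` and add its length to `un`. -/
def addCnt : Prog A X Y := .loop .cnt fun a => .seq (.push .un a) (.push .cnt' a)

theorem run_addCnt (l : List Unit) (s : Store A X Y) (h : s.cnt = l) :
    Run addCnt s { s with cnt := [], cnt' := l.reverse ++ s.cnt', un := l.reverse ++ s.un }
      (3 * l.length + 1) := by
  induction l generalizing s with
  | nil => exact (Run.loop_nil (k := .cnt) h).of_eq (by cases s; cases h; simp) (by simp)
  | cons a l ih =>
    refine (Run.loop_cons (k := .cnt) h ((Run.push .un a).seq (Run.push .cnt' a)) (ih _ rfl)).of_eq ?_ ?_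
    · simp [Store.set, Store.get]
    · simp; omega

theorem unit_list_ext {l l' : List Unit} (h : l.length = l'.length) : l = l' :=
  List.ext_getElem h fun _ _ _ => rfl

/-- Add the product of the lengths of `un'` and `cnt`, with one added to the latter, to `un`, and
empty `un'`. -/
def mulLoop : Prog A X Y :=
  .loop .un' fun a => .seq (.push .un a) (.seq addCnt restoreCnt)

/-- Each unit of `un'` costs one loop step, one push, `3 * n + 1` steps for `addCnt` and `2 * n + 1`
for `restoreCnt`, in total `5 * n + 4`. -/
theorem run_mulLoop (l : List Unit) (n : ℕ) (s : Store A X Y) (h : s.un' = l)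
    (hn : s.cnt.length = n) (h' : s.cnt' = []) :
    Run mulLoop s { s with un' := [], un := List.replicate (l.length * (n + 1)) () ++ s.un }
      (l.length * (5 * n + 4) + 1) := by
  induction l generalizing s with
  | nil => exact (Run.loop_nil (k := .un') h).of_eq (by cases s; cases h; simp) (by simp)
  | cons a l ih =>
    refine (Run.loop_cons (k := .un') h ((Run.push .un a).seq ((run_addCnt _ _ rfl).seq
      (run_restoreCnt _ _ rfl))) (ih _ rfl ?_ ?_)).of_eq ?_ ?_
    · simp [Store.set, h', hn]
    · simp
    · simp only [Store.set, Store.get, h', List.append_nil, List.reverse_reverse, Store.mk.injEq,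
        true_and, and_true]
      refine unit_list_ext ?_
      simp [hn]; ring
    · simp [Store.set, hn, h']; nlinarith

/-- Multiply the length of `un` by the length of `cnt` with one added. -/
def mulStep : Prog A X Y := .seq saveUn mulLoop

theorem run_mulStep (u n : ℕ) (s : Store A X Y) (h : s.un = List.replicate u ())
    (hu : s.un' = []) (hn : s.cnt.length = n) (h' : s.cnt' = []) :
    Run mulStep s { s with un := List.replicate (u * (n + 1)) () } (u * (5 * n + 6) + 2) := by
  refine ((run_saveUn _ _ rfl).seq (run_mulLoop _ n _ rfl hn h')).of_eq ?_ ?_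
  · simp [h, hu]
  · simp [h, hu]; nlinarith

/-- Iterate `mulStep`. -/
def power : ℕ → Prog A X Y
  | 0 => .skip
  | e + 1 => .seq (power e) mulStep

/-- A time bound for `power`. -/
def powerTime (u : ℕ) : ℕ → ℕ → ℕ
  | 0, _ => 1
  | e + 1, n => powerTime u e n + (u * (n + 1) ^ e * (5 * n + 6) + 2)

theorem run_power (e u n : ℕ) (s : Store A X Y) (h : s.un = List.replicate u ())
    (hu : s.un' = []) (hn : s.cnt.length = n) (h' : s.cnt' = []) :
    Run (power e) s { s with un := List.replicate (u * (n + 1) ^ e) () } (powerTime u e n) := by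
  induction e with
  | zero => exact Run.skip.of_eq (by cases s; cases h; simp) le_rfl
  | succ e ih =>
    refine (ih.seq (run_mulStep _ n _ rfl hu hn h')).of_eq ?_ le_rfl
    simp [pow_succ, mul_assoc]

theorem natPoly_powerTime (u e : ℕ) : NatPoly (powerTime u e) := by
  induction e with
  | zero => exact .const 1
  | succ e ih =>
    exact ih.add ((((NatPoly.const u).mul ((NatPoly.id.add (.const 1)).pow e)).mul
      (((NatPoly.const 5).mul .id).add (.const 6))).add (.const 2))

/-- Move the input to `word` and count it in `cnt`. -/
def readInput : Prog A X Y := .loop .inp fun a => .seq (.push .word a) (.push .cnt ())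

theorem run_readInput (l : List A) (s : Store A X Y) (h : s.inp = l) :
    Run readInput s { s with
      inp := [], word := l.reverse ++ s.word,
      cnt := List.replicate l.length () ++ s.cnt } (3 * l.length + 1) := by
  induction l generalizing s with
  | nil => exact (Run.loop_nil (k := .inp) h).of_eq (by cases s; cases h; simp) (by simp)
  | cons a l ih =>
    refine (Run.loop_cons (k := .inp) h ((Run.push .word a).seq (Run.push .cnt ())) (ih _ rfl)).of_eq ?_ ?_
    · simp only [Store.set, Store.get, List.reverse_cons, List.append_assoc, List.singleton_append,
        Store.mk.injEq, true_and, and_true]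
      exact unit_list_ext (by simp; omega)
    · simp; omega

/-- The data of the program. -/
structure Spec (A X Y : Type) where
  blank : X
  cell : A → X
  mark : X → X
  here : Y
  after : Y
  before : Y
  away : Y
  header : List Bool
  block : X → List Bool
  rows : X → List (List Bool × (Y → List Bool))
  factor : ℕ
  degree : ℕ

variable (S : Spec A X Y)

/-- Write blank cells. -/
def writeBlanks : Prog A X Y :=
  .loop .un fun _ => .seq (.push .tape S.blank) (.push .pat S.away)

theorem run_writeBlanks (u : ℕ) (s : Store A X Y) (h : s.un = List.replicate u ()) :
    Run (writeBlanks S) s { s with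
      un := [], tape := List.replicate u S.blank ++ s.tape,
      pat := List.replicate u S.away ++ s.pat } (3 * u + 1) := by
  induction u generalizing s with
  | zero => exact (Run.loop_nil (k := .un) h).of_eq (by simp at h; simp [← h]) (by simp)
  | succ u ih =>
    refine (Run.loop_cons (k := .un) h ((Run.push .tape S.blank).seq (Run.push .pat S.away))
      (ih _ rfl)).of_eq ?_ ?_
    · simp [Store.set, Store.get, List.replicate_succ']
    · omega

/-- Write the cells of the input. -/
def writeWord : Prog A X Y :=
  .loop .word fun a => .seq (.push .tape (S.cell a)) (.push .pat S.away)

theorem run_writeWord (l : List A) (s : Store A X Y) (h : s.word = l) :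
    Run (writeWord S) s { s with
      word := [], tape := (l.map S.cell).reverse ++ s.tape,
      pat := List.replicate l.length S.away ++ s.pat } (3 * l.length + 1) := by
  induction l generalizing s with
  | nil => exact (Run.loop_nil (k := .word) h).of_eq (by cases s; cases h; simp) (by simp)
  | cons a l ih =>
    refine (Run.loop_cons (k := .word) h ((Run.push .tape (S.cell a)).seq (Run.push .pat S.away))
      (ih _ rfl)).of_eq ?_ ?_
    · simp [Store.set, Store.get, List.replicate_succ']
    · simp; omega

end MatrixWriter

/-! ### Writing the rows, rotating the pattern, and the complete program. -/

namespace MatrixWriter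

open StackProg

variable {A X Y : Type}

/-- Write the images of the pattern. -/
def emitPattern (g : Y → List Bool) : Prog A X Y :=
  .loop .pat fun y => .seq (.push .pat' y) (pushes .acc (g y))

theorem run_emitPattern {g : Y → List Bool} {β : ℕ} (hg : ∀ y, (g y).length ≤ β) (l : List Y)
    (s : Store A X Y) (h : s.pat = l) :
    Run (emitPattern g) s { s with
      pat := [], pat' := l.reverse ++ s.pat', acc := (l.flatMap g).reverse ++ s.acc }
      (l.length * (β + 3) + 1) := by
  induction l generalizing s with
  | nil => exact (Run.loop_nil (k := .pat) h).of_eq (by cases s; cases h; simp) (by simp)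
  | cons a l ih =>
    refine (Run.loop_cons (k := .pat) h ((Run.push .pat' a).seq (run_pushes_acc _ _))
      (ih _ rfl)).of_eq ?_ ?_
    · simp [Store.set, Store.get]
    · have := hg a
      simp only [List.length_cons]
      nlinarith

/-- Write a row with a header. -/
def emitRow (r : List Bool × (Y → List Bool)) : Prog A X Y :=
  .seq (pushes .acc r.1) (.seq (emitPattern r.2) restorePat)

theorem run_emitRow {r : List Bool × (Y → List Bool)} {β : ℕ} (h₁ : r.1.length ≤ β)
    (h₂ : ∀ y, (r.2 y).length ≤ β) (s : Store A X Y) (h : s.pat' = []) :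
    Run (emitRow r) s { s with acc := (r.1 ++ s.pat.flatMap r.2).reverse ++ s.acc }
      (s.pat.length * (β + 5) + β + 3) := by
  refine ((run_pushes_acc _ _).seq ((run_emitPattern h₂ _ _ rfl).seq
    (run_restorePat _ _ rfl))).of_eq ?_ ?_
  · simp [h]
  · simp [h]
    nlinarith

/-- Write a list of rows. -/
def emitRows : List (List Bool × (Y → List Bool)) → Prog A X Y
  | [] => .skip
  | r :: rs => .seq (emitRow r) (emitRows rs)

theorem run_emitRows {rs : List (List Bool × (Y → List Bool))} {β : ℕ}
    (h₁ : ∀ r ∈ rs, r.1.length ≤ β) (h₂ : ∀ r ∈ rs, ∀ y, (r.2 y).length ≤ β) (s : Store A X Y)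
    (h : s.pat' = []) :
    Run (emitRows rs) s
      { s with acc := (rs.flatMap fun r => r.1 ++ s.pat.flatMap r.2).reverse ++ s.acc }
      (rs.length * (s.pat.length * (β + 5) + β + 3) + 1) := by
  induction rs generalizing s with
  | nil => exact Run.skip.of_eq (by simp) (by simp)
  | cons r rs ih =>
    refine ((run_emitRow (h₁ r (by simp)) (h₂ r (by simp)) s h).seq
      (ih (fun r hr => h₁ r (by simp [hr])) (fun r hr => h₂ r (by simp [hr])) _ h)).of_eq ?_ ?_
    · simp
    · simp only [List.length_cons]
      linarith

/-- Move the last element of a list to the front. -/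
def rotateRight (l : List Y) : List Y := l.reverse.head?.toList ++ l.reverse.tail.reverse

theorem length_rotateRight (l : List Y) : (rotateRight l).length = l.length := by
  rcases List.eq_nil_or_concat l with rfl | ⟨l, a, rfl⟩
  · rfl
  · simp [rotateRight]

/-- Rotate the stack `pat`. -/
def rotatePat : Prog A X Y :=
  .seq savePat (.pop .pat' fun o => .seq restorePat (o.elim .skip fun y => .push .pat y))

/-- Moving the pattern to `pat'` reverses it and exposes its last entry; the others are moved back
before that entry is pushed on top. -/
theorem run_rotatePat (s : Store A X Y) (h : s.pat' = []) :
    Run rotatePat s { s with pat := rotateRight s.pat } (4 * s.pat.length + 4) := by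
  rcases List.eq_nil_or_concat s.pat with h' | ⟨l, a, h'⟩
  · refine ((run_savePat _ _ rfl).seq (Run.pop (k := .pat') ((run_restorePat _ _ rfl).seq
      (s'' := s) (t' := 1) ?_))).of_eq ?_ ?_
    · simp only [h', h, Store.get, Store.set]
      exact Run.skip.of_eq (by cases s; cases h; cases h'; rfl) le_rfl
    · simp [h', rotateRight]; cases s; cases h'; rfl
    · simp [Store.set, Store.get, h', h]
  · refine ((run_savePat _ _ rfl).seq (Run.pop (k := .pat') ((run_restorePat _ _ rfl).seq
      (s'' := { s with pat := rotateRight s.pat }) (t' := 1) ?_))).of_eq rfl ?_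
    · have e : (l.concat a).reverse ++ [] = a :: l.reverse := by simp
      simp only [h', h, Store.get, Store.set, e]
      refine (Run.push .pat a).of_eq ?_ le_rfl
      simp [Store.set, Store.get, rotateRight]
    · simp [Store.set, Store.get, h', h]
      omega

/-- Write the blocks of the tape. -/
def emitBlocks (g : X → List Bool) : Prog A X Y :=
  .loop .tape fun x => .seq (.push .tape' x) (pushes .acc (g x))

theorem run_emitBlocks {g : X → List Bool} {β : ℕ} (hg : ∀ x, (g x).length ≤ β) (l : List X)
    (s : Store A X Y) (h : s.tape = l) :
    Run (emitBlocks g) s { s with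
      tape := [], tape' := l.reverse ++ s.tape', acc := (l.flatMap g).reverse ++ s.acc }
      (l.length * (β + 3) + 1) := by
  induction l generalizing s with
  | nil => exact (Run.loop_nil (k := .tape) h).of_eq (by cases s; cases h; simp) (by simp)
  | cons a l ih =>
    refine (Run.loop_cons (k := .tape) h ((Run.push .tape' a).seq (run_pushes_acc _ _))
      (ih _ rfl)).of_eq ?_ ?_
    · simp [Store.set, Store.get]
    · have := hg a
      simp only [List.length_cons]
      nlinarith

variable (S : Spec A X Y)

/-- The rows of a matrix, for the cells and the first pattern. -/
def matrix : List X → List Y → List Bool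
  | [], _ => []
  | x :: t, l => ((S.rows x).flatMap fun r => r.1 ++ l.flatMap r.2) ++ matrix t (rotateRight l)

/-- Write the matrix. -/
def emitMatrix : Prog A X Y :=
  .loop .tape fun x => .seq (emitRows (S.rows x)) rotatePat

/-- Bounds for the sizes of the blocks. -/
structure Spec.Bounded (β γ : ℕ) : Prop where
  header : S.header.length ≤ β
  block : ∀ x, (S.block x).length ≤ β
  rows : ∀ x, (S.rows x).length ≤ γ
  fst : ∀ x, ∀ r ∈ S.rows x, r.1.length ≤ β
  snd : ∀ x, ∀ r ∈ S.rows x, ∀ y, (r.2 y).length ≤ β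

variable {S} {β γ : ℕ}

theorem run_emitMatrix (hS : S.Bounded β γ) (N : ℕ) (t : List X) (s : Store A X Y)
    (h : s.tape = t) (h' : s.pat' = []) (hN : s.pat.length = N) :
    Run (emitMatrix S) s { s with
      tape := [], pat := rotateRight^[t.length] s.pat, acc := (matrix S t s.pat).reverse ++ s.acc }
      (t.length * (γ * (N * (β + 5) + β + 3) + 4 * N + 6) + 1) := by
  induction t generalizing s with
  | nil => exact (Run.loop_nil (k := .tape) h).of_eq (by cases s; cases h; simp [matrix]) (by simp)
  | cons x t ih =>
    refine (Run.loop_cons (k := .tape) h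
      ((run_emitRows (hS.fst x) (hS.snd x) { s with tape := t } h').seq
      (run_rotatePat _ h')) (ih _ ?_ ?_ ?_)).of_eq ?_ ?_
    · rfl
    · exact h'
    · exact (length_rotateRight _).trans hN
    · simp [matrix]
    · simp only [hN, List.length_cons]
      have := Nat.mul_le_mul_right (N * (β + 5) + β + 3) (hS.rows x)
      linarith

/-- Needed to bound the time of the final `flush`. -/
theorem length_matrix_le (hS : S.Bounded β γ) (N : ℕ) (t : List X) (l : List Y)
    (hl : l.length = N) : (matrix S t l).length ≤ t.length * (γ * (β + N * β)) := by
  induction t generalizing l with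
  | nil => simp [matrix]
  | cons x t ih =>
    have h₁ : ((S.rows x).flatMap fun r => r.1 ++ l.flatMap r.2).length ≤ γ * (β + N * β) := by
      rw [List.length_flatMap]
      refine (List.sum_le_card_nsmul _ (β + N * β) ?_).trans ?_
      · intro m hm
        obtain ⟨r, hr, rfl⟩ := List.mem_map.1 hm
        rw [List.length_append, List.length_flatMap]
        refine Nat.add_le_add (hS.fst x r hr) ((List.sum_le_card_nsmul _ β ?_).trans ?_)
        · intro m hm
          obtain ⟨y, _, rfl⟩ := List.mem_map.1 hm
          exact hS.snd x r hr y
        · simp [hl]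
      · simpa using Nat.mul_le_mul_right _ (hS.rows x)
    have h₂ := ih _ ((length_rotateRight l).trans hl)
    simp only [matrix, List.length_append, List.length_cons]
    linarith

variable (S)

/-- Mark the first cell. -/
def markFirst : Prog A X Y :=
  .pop .tape fun o => o.elim .skip fun x => .push .tape (S.mark x)

theorem run_markFirst (x : X) (l : List X) (s : Store A X Y) (h : s.tape = x :: l) :
    Run (markFirst S) s { s with tape := S.mark x :: l } 2 := by
  refine (Run.pop (k := .tape) (t := 1) ?_).of_eq rfl le_rfl
  simp only [Store.get, h]
  refine (Run.push .tape (S.mark x)).of_eq ?_ le_rfl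
  simp [Store.set, Store.get]

/-- Write the cells after the input. -/
def writeTail : Prog A X Y :=
  .seq (.push .pat S.before) <| .seq (.push .tape S.blank) <| .seq (.push .tape S.blank) <|
    .push .tape S.blank

theorem run_writeTail (s : Store A X Y) :
    Run (writeTail S) s { s with
      pat := S.before :: s.pat, tape := S.blank :: S.blank :: S.blank :: s.tape } 4 :=
  (Run.push .pat S.before).seq ((Run.push .tape S.blank).seq ((Run.push .tape S.blank).seq
    (Run.push .tape S.blank)))

/-- Write the first two entries of the pattern. -/
def writeHead : Prog A X Y := .seq (.push .pat S.after) (.push .pat S.here)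

theorem run_writeHead (s : Store A X Y) :
    Run (writeHead S) s { s with pat := S.here :: S.after :: s.pat } 2 :=
  (Run.push .pat S.after).seq (Run.push .pat S.here)

/-- Push a number of units on `un`. -/
def pushUn : ℕ → Prog A X Y
  | 0 => .skip
  | u + 1 => .seq (.push .un ()) (pushUn u)

theorem run_pushUn (u : ℕ) (s : Store A X Y) :
    Run (pushUn u) s { s with un := List.replicate u () ++ s.un } (u + 1) := by
  induction u generalizing s with
  | zero => exact Run.skip
  | succ u ih =>
    refine ((Run.push .un ()).seq (ih _)).of_eq ?_ (by omega)
    simp only [Store.set, Store.get, Store.mk.injEq, true_and, and_true]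
    exact unit_list_ext (by simp; omega)

/-- Write the tape and the first pattern. -/
def prepare : Prog A X Y :=
  .seq (pushUn S.factor) <| .seq readInput <| .seq (power S.degree) <| .seq (writeTail S) <|
    .seq (writeBlanks S) <| .seq (writeWord S) <| .seq (writeHead S) <| .seq (markFirst S) clearCnt

/-- The number of blanks after the input, without the last three. -/
def Spec.pad (n : ℕ) : ℕ := S.factor * (n + 1) ^ S.degree

/-- The number of cells. -/
def Spec.size (n : ℕ) : ℕ := n + S.pad n + 3

/-- The tape without the mark. -/
def Spec.cells (w : List A) : List X :=
  w.map S.cell ++ List.replicate (S.pad w.length + 3) S.blank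

/-- The tape. -/
def Spec.markedCells (w : List A) : List X := (S.cells w).modifyHead S.mark

/-- The first pattern. -/
def Spec.pattern (n : ℕ) : List Y :=
  S.here :: S.after :: (List.replicate (n + S.pad n) S.away ++ [S.before])

/-- A time bound for `prepare`. -/
def Spec.prepareTime (n : ℕ) : ℕ :=
  powerTime S.factor S.degree n + (8 * n + 3 * S.pad n + (S.factor + 20))

/-- The stacks that hold only the given input, output, tape and pattern. -/
def Store.of (inp : List A) (out : List Bool) (tape : List X) (pat : List Y) : Store A X Y :=
  ⟨inp, out, [], tape, [], pat, [], [], [], [], [], []⟩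

/-- Stacks fill from the bottom, so tape and pattern are written from back to front. The input is
reversed once on its way to `word` and again on its way to `tape`. -/
theorem run_prepare (w : List A) :
    Run (prepare S) (Store.of w [] [] [])
      (Store.of [] [] (S.markedCells w) (S.pattern w.length)) (S.prepareTime w.length) := by
  obtain ⟨x, l, hx⟩ : ∃ x l, S.cells w = x :: l := by
    cases h : S.cells w with
    | nil => simp [Spec.cells] at h
    | cons x l => exact ⟨x, l, rfl⟩
  have hx' : (w.map S.cell) ++ (List.replicate (S.pad w.length) S.blank ++
      [S.blank, S.blank, S.blank]) = x :: l := by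
    rw [← hx, Spec.cells, List.replicate_add]; rfl
  let n := w.length
  let u := List.replicate n ()
  let tl := List.replicate (S.pad n) S.blank ++ [S.blank, S.blank, S.blank]
  let pl := List.replicate (S.pad n) S.away ++ [S.before]
  let pl' := List.replicate n S.away ++ pl
  have h₁ : Run (A := A) (X := X) (Y := Y) (pushUn S.factor) (Store.of w [] [] [])
      ⟨w, [], [], [], [], [], [], [], [], [], List.replicate S.factor (), []⟩ _ :=
    (run_pushUn S.factor _).of_eq (by simp [Store.of]) le_rfl
  have h₂ : Run (A := A) (X := X) (Y := Y) readInput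
      ⟨w, [], [], [], [], [], [], [], [], [], List.replicate S.factor (), []⟩
      ⟨[], [], [], [], [], [], [], w.reverse, u, [], List.replicate S.factor (), []⟩ _ :=
    (run_readInput w _ rfl).of_eq (by simp [u, n]) le_rfl
  have h₃ : Run (A := A) (X := X) (Y := Y) (power S.degree)
      ⟨[], [], [], [], [], [], [], w.reverse, u, [], List.replicate S.factor (), []⟩
      ⟨[], [], [], [], [], [], [], w.reverse, u, [], List.replicate (S.pad n) (), []⟩ _ :=
    run_power S.degree S.factor n _ rfl rfl (by simp [u]) rfl
  have h₄ : Run (A := A) (X := X) (Y := Y) (writeTail S)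
      ⟨[], [], [], [], [], [], [], w.reverse, u, [], List.replicate (S.pad n) (), []⟩
      ⟨[], [], [], [S.blank, S.blank, S.blank], [], [S.before], [], w.reverse, u, [],
        List.replicate (S.pad n) (), []⟩ _ := run_writeTail S _
  have h₅ : Run (A := A) (X := X) (Y := Y) (writeBlanks S)
      ⟨[], [], [], [S.blank, S.blank, S.blank], [], [S.before], [], w.reverse, u, [],
        List.replicate (S.pad n) (), []⟩
      ⟨[], [], [], tl, [], pl, [], w.reverse, u, [], [], []⟩ _ := run_writeBlanks S (S.pad n) _ rfl
  have h₆ : Run (A := A) (X := X) (Y := Y) (writeWord S)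
      ⟨[], [], [], tl, [], pl, [], w.reverse, u, [], [], []⟩
      ⟨[], [], [], x :: l, [], pl', [], [], u, [], [], []⟩ _ :=
    (run_writeWord S w.reverse _ rfl).of_eq (by simp [tl, pl', ← hx', n]) le_rfl
  have h₇ : Run (A := A) (X := X) (Y := Y) (writeHead S)
      ⟨[], [], [], x :: l, [], pl', [], [], u, [], [], []⟩
      ⟨[], [], [], x :: l, [], S.here :: S.after :: pl', [], [], u, [], [], []⟩ _ :=
    run_writeHead S _
  have h₈ : Run (A := A) (X := X) (Y := Y) (markFirst S)
      ⟨[], [], [], x :: l, [], S.here :: S.after :: pl', [], [], u, [], [], []⟩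
      ⟨[], [], [], S.mark x :: l, [], S.here :: S.after :: pl', [], [], u, [], [], []⟩ _ :=
    run_markFirst S x l _ rfl
  have h₉ : Run (A := A) (X := X) (Y := Y) clearCnt
      ⟨[], [], [], S.mark x :: l, [], S.here :: S.after :: pl', [], [], u, [], [], []⟩
      (Store.of [] [] (S.markedCells w) (S.pattern n)) _ :=
    (run_clearCnt u _ rfl).of_eq (by
      simp [Store.of, Spec.markedCells, hx, Spec.pattern, pl', pl, List.replicate_add,
        -List.replicate_append_replicate]) le_rfl
  refine (h₁.seq (h₂.seq (h₃.seq (h₄.seq (h₅.seq (h₆.seq (h₇.seq (h₈.seq h₉)))))))).mono ?_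
  simp only [List.length_reverse, Spec.prepareTime, u, List.length_replicate, n]
  omega

/-- The output of the program. -/
def Spec.output (w : List A) : List Bool :=
  S.header ++ ((S.markedCells w).flatMap S.block ++
    matrix S (S.markedCells w) (S.pattern w.length))

/-- The program. -/
def main : Prog A X Y :=
  .seq (prepare S) <| .seq (pushes .acc S.header) <| .seq (emitBlocks S.block) <|
    .seq restoreTape <| .seq (emitMatrix S) <| .seq clearPat flush

/-- A time bound for the program. -/
def Spec.time (β γ n : ℕ) : ℕ :=
  S.prepareTime n + ((S.size n * (γ * (S.size n * (β + 5) + β + 3) + 4 * S.size n + 6)) +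
    2 * (S.size n * β + S.size n * (γ * (β + S.size n * β))) + S.size n * (β + 7) + (3 * β + 20))

theorem length_markedCells (w : List A) : (S.markedCells w).length = S.size w.length := by
  simp [Spec.markedCells, Spec.cells, Spec.size]
  omega

theorem length_pattern (n : ℕ) : (S.pattern n).length = S.size n := by
  simp [Spec.pattern, Spec.size]

variable {S}

theorem run_main (hS : S.Bounded β γ) (w : List A) :
    Run (main S) (Store.of w [] [] []) (Store.of [] (S.output w) [] [])
      (S.time β γ w.length) := by
  let t := S.markedCells w
  let p := S.pattern w.length
  let o := S.output w
  let N := S.size w.length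
  have ht : t.length = N := length_markedCells S w
  have hp : p.length = N := length_pattern S _
  have ho : o.length ≤ β + (N * β + N * (γ * (β + N * β))) := by
    have h₁ : (t.flatMap S.block).length ≤ N * β := by
      rw [List.length_flatMap]
      refine (List.sum_le_card_nsmul _ β ?_).trans (by simp [ht])
      intro m hm
      obtain ⟨x, _, rfl⟩ := List.mem_map.1 hm
      exact hS.block x
    have h₂ := length_matrix_le hS N t p hp
    rw [ht] at h₂
    simp only [o, Spec.output, List.length_append]
    exact Nat.add_le_add hS.header (Nat.add_le_add h₁ h₂)
  have h₁ : Run (A := A) (X := X) (Y := Y) (pushes .acc S.header) (Store.of [] [] t p)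
      ⟨[], [], S.header.reverse, t, [], p, [], [], [], [], [], []⟩ _ :=
    (run_pushes_acc S.header _).of_eq (by simp [Store.of]) le_rfl
  have h₂ : Run (A := A) (X := X) (Y := Y) (emitBlocks S.block)
      ⟨[], [], S.header.reverse, t, [], p, [], [], [], [], [], []⟩
      ⟨[], [], (t.flatMap S.block).reverse ++ S.header.reverse, [], t.reverse, p, [], [], [], [],
        [], []⟩ _ :=
    (run_emitBlocks hS.block t _ rfl).of_eq (by simp) le_rfl
  have h₃ : Run (A := A) (X := X) (Y := Y) restoreTape
      ⟨[], [], (t.flatMap S.block).reverse ++ S.header.reverse, [], t.reverse, p, [], [], [], [],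
        [], []⟩
      ⟨[], [], (t.flatMap S.block).reverse ++ S.header.reverse, t, [], p, [], [], [], [], [], []⟩
      _ :=
    (run_restoreTape t.reverse _ rfl).of_eq (by simp) le_rfl
  have h₄ : Run (A := A) (X := X) (Y := Y) (emitMatrix S)
      ⟨[], [], (t.flatMap S.block).reverse ++ S.header.reverse, t, [], p, [], [], [], [], [], []⟩
      ⟨[], [], o.reverse, [], [], rotateRight^[t.length] p, [], [], [], [], [], []⟩ _ :=
    (run_emitMatrix hS N t _ rfl rfl hp).of_eq (by simp [o, Spec.output, t, p]) le_rfl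
  have h₅ : Run (A := A) (X := X) (Y := Y) clearPat
      ⟨[], [], o.reverse, [], [], rotateRight^[t.length] p, [], [], [], [], [], []⟩
      ⟨[], [], o.reverse, [], [], [], [], [], [], [], [], []⟩ _ := run_clearPat _ _ rfl
  have h₆ : Run (A := A) (X := X) (Y := Y) flush
      ⟨[], [], o.reverse, [], [], [], [], [], [], [], [], []⟩
      (Store.of [] o [] []) _ :=
    (run_flush o.reverse _ rfl).of_eq (by simp [Store.of]) le_rfl
  have hrot : ∀ k, (rotateRight^[k] p).length = N := by
    intro k
    induction k with
    | zero => exact hp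
    | succ k ih => rw [Function.iterate_succ_apply', length_rotateRight, ih]
  refine ((run_prepare S w).seq (h₁.seq (h₂.seq (h₃.seq (h₄.seq (h₅.seq h₆)))))).mono ?_
  rw [List.length_reverse, List.length_reverse, ht, hrot, Spec.time]
  have := hS.header
  linarith

theorem natPoly_time (β γ : ℕ) : NatPoly (S.time β γ) := by
  have hpad : NatPoly S.pad := (NatPoly.const _).mul ((NatPoly.id.add (.const 1)).pow _)
  have hsize : NatPoly S.size := (NatPoly.id.add hpad).add (.const 3)
  have hprep : NatPoly S.prepareTime := (natPoly_powerTime _ _).add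
    ((((NatPoly.const 8).mul .id).add ((NatPoly.const 3).mul hpad)).add (.const _))
  exact hprep.add ((((hsize.mul (((((NatPoly.const γ).mul (((hsize.mul (.const _)).add
    (.const β)).add (.const 3))).add ((NatPoly.const 4).mul hsize)).add (.const 6)))).add
    ((NatPoly.const 2).mul ((hsize.mul (.const β)).add (hsize.mul ((NatPoly.const γ).mul
    ((NatPoly.const β).add (hsize.mul (.const β)))))))).add (hsize.mul (.const _))).add (.const _))

/-- The output of the program is computable in polynomial time. -/
theorem computable_output [Finite A] [Finite X] [Finite Y] (hS : S.Bounded β γ) :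
    Nonempty (Turing.TM2ComputableInPolyTime (id : List A → List A) (id : List Bool → List Bool)
      S.output) := by
  obtain ⟨q, hq⟩ := natPoly_time (S := S) β γ
  refine StackProg.computableInPolyTime (Γ := Sym A X Y) (k₀ := .inp) (k₁ := .out) (main S)
    S.output q fun w => ?_
  have h := run_main hS w
  rw [hq, Run] at h
  convert h using 1
  · funext k
    cases k <;> rfl
  · funext k
    cases k <;> rfl

end MatrixWriter

/-! ### The code of the Kripke structure of a machine -/

namespace KripkeStructure

/-- Transport along a bijection of the states. -/
def comap {S S' AP : Type*} (K : KripkeStructure S AP) (e : S' ≃ S) : KripkeStructure S' AP where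
  init := e.symm K.init
  δ s := e ⁻¹' K.δ (e s)
  δ_nonempty s := (K.δ_nonempty (e s)).preimage e.surjective
  L s := K.L (e s)

theorem bit_of {P : Prop} (h : P) : bit P = true := by simp [bit, h]

theorem bit_of_not {P : Prop} (h : ¬ P) : bit P = false := by simp [bit, h]

theorem bit_congr {P Q : Prop} (h : P ↔ Q) : bit P = bit Q := by rw [propext h]

theorem traces_comap {S S' AP : Type*} (K : KripkeStructure S AP) (e : S' ≃ S) :
    (K.comap e).traces = K.traces := by
  ext t
  constructor
  · rintro ⟨p, h₀, h, ht⟩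
    exact ⟨e ∘ p, by simp [h₀, comap], h, ht⟩
  · rintro ⟨p, h₀, h, ht⟩
    exact ⟨e.symm ∘ p, by simp [h₀, comap], fun i => by simpa [comap] using h i,
      fun i => by simp [comap, ht]⟩

/-- A word codes at most one structure, by `encode_injective`. -/
theorem encode_mem_modelChecking {n m : ℕ} (K : KripkeStructure (Fin n) (Fin m))
    (ψ : HyperLTL.Formula (Fin m)) : K.encode ∈ ψ.modelChecking ↔ K.Satisfies ψ := by
  constructor
  · rintro ⟨n', K', h, hs⟩
    have := encode_injective m (a₁ := ⟨n', K'⟩) (a₂ := ⟨n, K⟩) h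
    exact (congrArg (fun K : Σ n, KripkeStructure (Fin n) (Fin m) => K.2.Satisfies ψ) this).mp hs
  · exact fun h => ⟨n, K, rfl, h⟩

variable {N C : ℕ} {R : Type}

/-- The numbering of the states: the initial state first, then the pairs in lexicographic order. -/
def stateEquiv (N : ℕ) (e : Fin C ≃ R) : Fin (N * C + 1) ≃ Option (Fin N × R) :=
  (finSuccEquiv (N * C)).trans
    (Equiv.optionCongr (finProdFinEquiv.symm.trans (Equiv.prodCongr (Equiv.refl _) e)))

/-- Lists indexed by states split into the entry of the initial state and one block of length `C`
per distance. -/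
theorem ofFn_stateEquiv {α : Type*} (e : Fin C ≃ R) (g : Option (Fin N × R) → α) :
    (List.ofFn fun i => g (stateEquiv N e i)) =
      g none :: (List.ofFn fun d => List.ofFn fun r => g (some (d, e r))).flatten := by
  have h₀ : stateEquiv N e 0 = none := by simp [stateEquiv]
  rw [List.ofFn_succ, h₀, List.ofFn_mul]
  congr 3
  funext d
  congr 1
  funext r
  congr 1
  have : (⟨(d : ℕ) * C + r, by
      calc (d : ℕ) * C + r < (d + 1) * C := by rw [Nat.add_mul, one_mul]; omega
        _ ≤ N * C := Nat.mul_le_mul_right _ d.2⟩ : Fin (N * C)) = finProdFinEquiv (d, r) := by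
    ext
    simp [finProdFinEquiv]
    ring
  rw [this]
  simp only [stateEquiv, Equiv.trans_apply, finSuccEquiv_succ, Equiv.optionCongr_apply,
    Option.map_some, Equiv.symm_apply_apply, Equiv.prodCongr_apply]
  rfl

/-- The code of a state before the numbering. -/
noncomputable def row (K : KripkeStructure (Option (Fin N × R)) (Fin 2)) (e : Fin C ≃ R)
    (s : Option (Fin N × R)) : List Bool :=
  bit (s = K.init) :: bit (0 ∈ K.L s) :: bit (1 ∈ K.L s) :: bit (none ∈ K.δ s) ::
    (List.ofFn fun d => List.ofFn fun r => bit (some (d, e r) ∈ K.δ s)).flatten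

theorem encode_comap (K : KripkeStructure (Option (Fin N × R)) (Fin 2)) (e : Fin C ≃ R) :
    (K.comap (stateEquiv N e)).encode = K.row e none ++
      (List.ofFn fun d => (List.ofFn fun r => K.row e (some (d, e r))).flatten).flatten := by
  have h : ∀ s, (K.comap (stateEquiv N e)).encodeState s = K.row e (stateEquiv N e s) := by
    intro s
    have := ofFn_stateEquiv (N := N) e fun t => bit (t ∈ K.δ (stateEquiv N e s))
    rw [row, ← this]
    simp [encodeState, comap, Equiv.eq_symm_apply]
  rw [encode, funext h, ofFn_stateEquiv, List.flatten_cons, List.flatten_flatten, List.map_ofFn]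
  rfl

end KripkeStructure

/-! ### The circulant form of the matrix. -/

namespace MatrixWriter

theorem matrix_ofFn {A X Y : Type} (S : Spec A X Y) {N : ℕ} (W : Fin N → X) (l : List Y) :
    matrix S (List.ofFn W) l = (List.ofFn fun i : Fin N =>
      (S.rows (W i)).flatMap fun r => r.1 ++ (rotateRight^[i] l).flatMap r.2).flatten := by
  induction N generalizing l with
  | zero => simp [matrix]
  | succ N ih =>
    rw [List.ofFn_succ, List.ofFn_succ, matrix, ih]
    rfl

theorem rotateRight_ofFn {Y : Type} {k : ℕ} (p : Fin (k + 1) → Y) :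
    rotateRight (List.ofFn p) = List.ofFn fun i => p (i - 1) := by
  have h₁ : List.ofFn p = (List.ofFn fun i : Fin k => p i.castSucc) ++ [p (Fin.last k)] := by
    rw [List.ofFn_succ', List.concat_eq_append]
  have h₂ : (0 : Fin (k + 1)) - 1 = Fin.last k := by
    rw [zero_sub]
    exact (eq_neg_of_add_eq_zero_left (Fin.last_add_one k)).symm
  have h₃ : ∀ i : Fin k, i.succ - 1 = i.castSucc := fun i =>
    sub_eq_iff_eq_add.2 Fin.coeSucc_eq_succ.symm
  rw [h₁, List.ofFn_succ, h₂]
  simp [rotateRight, h₃]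

/-- Entry `i` of the pattern for block row `j` depends only on `i - j`: this is the circulant
property. -/
theorem iterate_rotateRight_ofFn {Y : Type} {k : ℕ} (p : Fin (k + 1) → Y) (j : ℕ) :
    rotateRight^[j] (List.ofFn p) = List.ofFn fun i => p (i - Fin.ofNat (k + 1) j) := by
  induction j generalizing p with
  | zero => simp
  | succ j ih =>
    have : Fin.ofNat (k + 1) (j + 1) = Fin.ofNat (k + 1) j + 1 := by ext; simp [Fin.val_add]
    rw [Function.iterate_succ_apply', ih, rotateRight_ofFn, this]
    congr 1
    funext i
    congr 1
    abel

end MatrixWriter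

/-- The move of the head that leads to a given change of the distance. -/
def shiftOf {N : ℕ} [NeZero N] (d : Fin N) : Option SignType :=
  if d = 0 then some 0 else if d = 1 then some (-1) else if d = -1 then some 1 else none

/-- With at least three cells, `0`, `1` and `-1` are distinct modulo the tape length. This is why
the tape has three extra blanks. -/
theorem shiftOf_eq_some {k : ℕ} (d : Fin (k + 3)) (v : SignType) :
    shiftOf d = some v ↔ d = -(v : Fin (k + 3)) := by
  have h₁ : (1 : Fin (k + 3)) ≠ 0 := by simp
  have h₂ : (1 : Fin (k + 3)) ≠ -1 := by
    rw [Ne, eq_neg_iff_add_eq_zero, Fin.ext_iff]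
    simp [Fin.val_add, Nat.mod_eq_of_lt]
  have h₃ : (-1 : Fin (k + 3)) ≠ 0 := by simp
  unfold shiftOf
  cases v <;> split_ifs <;> simp_all [eq_comm]

theorem ofFn_shiftOf (k : ℕ) : List.ofFn (shiftOf : Fin (k + 3) → Option SignType) =
    some 0 :: some (-1) :: (List.replicate k none ++ [some 1]) := by
  have hl : Fin.last (k + 2) = -1 := by
    rw [eq_neg_iff_add_eq_zero, Fin.last_add_one]
  have h₁ : shiftOf (0 : Fin (k + 3)) = some 0 := by simp [shiftOf]
  have h₂ : shiftOf (1 : Fin (k + 3)) = some (-1) := by simp [shiftOf]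
  have h₃ : shiftOf (-1 : Fin (k + 3)) = some 1 := by rw [shiftOf_eq_some]; simp
  rw [List.ofFn_succ, List.ofFn_succ, List.ofFn_succ', List.concat_eq_append, h₁]
  congr 2
  congr 1
  · rw [← List.ofFn_const]
    congr 1
    funext i
    have e₁ : (i.castSucc.succ.succ : Fin (k + 3)) ≠ 0 := by simp
    have e₂ : (i.castSucc.succ.succ : Fin (k + 3)) ≠ 1 := by simp [Fin.ext_iff]
    have e₃ : (i.castSucc.succ.succ : Fin (k + 3)) ≠ -1 := by
      rw [← hl, Ne, Fin.ext_iff]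
      simp
      omega
    simp [shiftOf, e₁, e₂, e₃]
  · rw [← h₃, ← hl]
    rfl

/-! ### The reduction and its correctness. -/

namespace SpaceTM

open MatrixWriter KripkeStructure

variable {A : Type} (M : SpaceTM A) (f : M.Cell → M.Cell)

/-- The local states of the Kripke structure of the simulating machine. -/
abbrev LocalState : Type := BitMachine.Loc M.Cell (M.Q × M.Cell)

variable {C : ℕ} (e : Fin C ≃ M.LocalState)

/-- The data for writing the code of the Kripke structure. -/
noncomputable def spec (factor degree : ℕ) : Spec A M.Cell (Option SignType) where
  blank := (M.blank, false)
  cell a := (M.input a, false)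
  mark x := (x.1, true)
  here := some 0
  after := some (-1)
  before := some 1
  away := none
  header := [true, false, false, false]
  block x := List.ofFn fun r => bit ((e r).1 = x ∧ (e r).2.1 = (M.toBitMachine f).start)
  rows x := List.ofFn fun r =>
    ([false, bit ((e r).2.2 = true), bit ((M.toBitMachine f).Bad x.2 (e r)), false], fun y =>
      List.ofFn fun r' => bit (y = some ((M.toBitMachine f).move (e r).2.1 (e r).2.2) ∧
        (e r').1 = (M.toBitMachine f).nextCell x.2 (e r) ∧
        (e r').2.1 = (M.toBitMachine f).next (e r).2.1 (e r).2.2))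
  factor := factor
  degree := degree

theorem bounded_spec (c d : ℕ) : (M.spec f e c d).Bounded (C + 4) C where
  header := by simp [spec]
  block x := by simp [spec]
  rows x := by simp [spec]
  fst x r hr := by
    obtain ⟨i, rfl⟩ := List.mem_ofFn.1 hr
    simp
  snd x r hr y := by
    obtain ⟨i, rfl⟩ := List.mem_ofFn.1 hr
    simp

theorem markedCells_spec (c d : ℕ) (w : List A) : (M.spec f e c d).markedCells w =
    List.ofFn (M.initTape (w.length + (M.spec f e c d).pad w.length + 3) w) := by
  refine List.ext_getElem ?_ fun i h₁ h₂ => ?_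
  · rw [length_markedCells, List.length_ofFn, Spec.size]
  · rw [List.getElem_ofFn]
    cases i with
    | zero =>
      cases w <;> simp [Spec.markedCells, Spec.cells, initTape, spec, List.replicate_succ] <;> rfl
    | succ i =>
      have : ((⟨i + 1, by rwa [List.length_ofFn] at h₂⟩ : Fin (w.length + (M.spec f e c d).pad w.length + 3)) == 0)
          = false := by
        simp [Fin.ext_iff]
      simp only [Spec.markedCells, Spec.cells, initTape, this, List.getElem_modifyHead]
      by_cases hi : i + 1 < w.length
      · simp [spec, hi]
      · simp [spec, List.getElem_append, hi]

/-- Both sides have the same blocks; what remains is to match the rotated pattern with the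
transition relation. -/
theorem output_spec (c d : ℕ) (w : List A) : (M.spec f e c d).output w =
    (((M.toBitMachine f).kripke
      (M.initTape (w.length + (M.spec f e c d).pad w.length + 3) w)).comap
        (stateEquiv _ e)).encode := by
  set k := w.length + (M.spec f e c d).pad w.length with hk
  have hp : (M.spec f e c d).pattern w.length =
      List.ofFn (shiftOf : Fin (k + 3) → Option SignType) := by
    rw [ofFn_shiftOf]; rfl
  rw [encode_comap, Spec.output, markedCells_spec, hp, matrix_ofFn, ← List.append_assoc]
  set B := M.toBitMachine f with hB
  set W := M.initTape (k + 3) w with hW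
  congr 1
  · have h₁ : bit (none = (B.kripke W).init) = true := bit_of rfl
    have h₂ : ∀ a, bit (a ∈ (B.kripke W).L none) = false := fun a =>
      bit_of_not (by simp [B.L_kripke_none W])
    rw [row, h₁, h₂, h₂, bit_of_not (B.none_notMem_δ_kripke W none), List.flatMap_def, List.map_ofFn]
    refine congrArg (fun l => [true, false, false, false] ++ l)
      (congrArg List.flatten (congrArg List.ofFn (funext fun i => ?_)))
    exact congrArg List.ofFn (funext fun r => bit_congr (B.mem_δ_kripke_none W i (e r)).symm)
  · refine congrArg List.flatten (congrArg List.ofFn (funext fun i => ?_))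
    simp only [spec, List.flatMap_def, List.map_ofFn]
    refine congrArg List.flatten (congrArg List.ofFn (funext fun r => ?_))
    have h₁ : bit (some (i, e r) = (B.kripke W).init) = false :=
      bit_of_not (Option.some_ne_none _)
    rw [row, h₁, bit_congr (B.zero_mem_L_kripke W i (e r)), bit_congr (B.one_mem_L_kripke W i (e r)),
      bit_of_not (B.none_notMem_δ_kripke W _), Function.comp_apply, iterate_rotateRight_ofFn,
      List.map_ofFn]
    refine congrArg (fun l => [false, bit ((e r).2.2 = true), bit (B.Bad (i == 0) (e r)), false] ++ l)
      (congrArg List.flatten (congrArg List.ofFn (funext fun i' => ?_)))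
    refine congrArg List.ofFn (funext fun r' => bit_congr ?_)
    -- The change of the distance is the negative of the move, which is what the rotated pattern
    -- records at column `i'` of block row `i`.
    have : i' = i - (B.move (e r).2.1 (e r).2.2 : Fin (k + 3)) ↔
        shiftOf (i' - Fin.ofNat (k + 3) i) = some (B.move (e r).2.1 (e r).2.2) := by
      rw [shiftOf_eq_some, sub_eq_iff_eq_add, neg_add_eq_sub]
      simp
    rw [B.mem_δ_kripke_some W, this]
    rfl

theorem satisfies_iff {L : Language A} {p : Polynomial ℕ} (hM : M.DecidesInSpace L fun n => p.eval n)
    (hf : ∀ x y, ∃ j, f^[j] x = y) {c d : ℕ} (hcd : ∀ n, p.eval n ≤ c * (n + 1) ^ d) (j : ℕ)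
    (w : List A) :
    w ∈ L ↔ (M.spec f e c d).output w ∈ (HyperLTL.Formula.hard j).modelChecking := by
  have hN : p.eval w.length ≤ w.length + (M.spec f e c d).pad w.length + 3 := by
    have := hcd w.length
    simp only [Spec.pad, spec]
    omega
  rw [output_spec, encode_mem_modelChecking, Satisfies, traces_comap]
  refine Iff.trans ?_ (BitMachine.satisfies_kripke _ _ j).symm
  rw [hM.rejects_iff hf hN, not_not]

end SpaceTM

/-- The program computes only bounds of this shape. The base `n + 1` is positive, so exponents can
be raised to a common maximum. -/
theorem exists_eval_le_mul_pow (p : Polynomial ℕ) : ∃ c d, ∀ n, p.eval n ≤ c * (n + 1) ^ d := by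
  induction p using Polynomial.induction_on' with
  | add p q hp hq =>
    obtain ⟨c, d, h⟩ := hp
    obtain ⟨c', d', h'⟩ := hq
    refine ⟨c + c', max d d', fun n => ?_⟩
    rw [Polynomial.eval_add, add_mul]
    refine Nat.add_le_add ((h n).trans ?_) ((h' n).trans ?_)
    · exact Nat.mul_le_mul_left _ (Nat.pow_le_pow_right n.succ_pos (le_max_left _ _))
    · exact Nat.mul_le_mul_left _ (Nat.pow_le_pow_right n.succ_pos (le_max_right _ _))
  | monomial k a =>
    refine ⟨a, k, fun n => ?_⟩
    rw [Polynomial.eval_monomial]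
    exact Nat.mul_le_mul_left _ (Nat.pow_le_pow_left n.le_succ _)

theorem pspaceHard_modelChecking_hard (j : ℕ) :
    PSPACEHard (HyperLTL.Formula.hard j).modelChecking := by
  rintro A _ L ⟨M, p, hM⟩
  have := M.finQ
  have := M.finΓ
  obtain ⟨f, hf⟩ := exists_transitive_map M.Cell
  obtain ⟨C, ⟨e⟩⟩ := Finite.exists_equiv_fin M.LocalState
  obtain ⟨c, d, hcd⟩ := exists_eval_le_mul_pow p
  exact ⟨_, MatrixWriter.computable_output (M.bounded_spec f e.symm c d),
    M.satisfies_iff f e.symm hM hf hcd j⟩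

theorem mainTheorem2 (k : ℕ) (hk : 1 ≤ k) :
    ∃ (m : ℕ) (ψ : HyperLTL.Formula (Fin m)),
      ψ.Closed ∧ ψ.alternations = k ∧ PSPACEHard ψ.modelChecking := by
  -- The core formula already has one alternation, so `k - 1` dummy quantifiers are added.
  refine ⟨2, .hard (k - 1), HyperLTL.Formula.hard_closed _, ?_, pspaceHard_modelChecking_hard _⟩
  rw [HyperLTL.Formula.alternations_hard, Nat.sub_add_cancel hk]
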